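/- Let $n\ge 1$, $\beta>0$ and let $X=(X(t))_{t\in\mathbb R^n}$ be a Gaussian field with generalized Cauchy covariance (GFGCC), i.e. a real stationary Gaussian field with mean zero and $\mathbb E[X(t+\tau)X(t)]=(1+\|\tau\|^{\alpha})^{-\beta}$ for all $t,\tau\in\mathbb R^n$, where $\alpha\in(0,2]$. Put $C(t)=\mathbb E[X(t)X(0)]$. A function $S$ on $\mathbb R^n\setminus\{0\}$ is called the spectral density of $X$ if (a) for every $\omega\ne0$ at which the Fourier integral $\frac1{(2\pi)^n}\int_{\mathbb R^n}e^{-i\omega\cdot t}C(t)\,d^nt$ converges (as the limit, for $R\to\infty$, of the integrals over $\|t\|\le R$), its value is $S(\omega)$; (b) $S$ is the Fourier transform of $C$ as a tempered distribution: for every Schwartz function $\psi$ on $\mathbb R^n$, $\int S(\omega)\psi(\omega)\,d^n\omega=\int C(t)\hat\psi(t)\,d^nt$, both integrals being absolutely convergent, where $\hat\psi(t)=\frac1{(2\pi)^n}\int e^{-i\omega\cdot t}\psi(\omega)\,d^n\omega$; (c) $S$ is integrable and $C(t)=\int_{\mathbb R^n}e^{i\omega\cdot t}S(\omega)\,d^n\omega$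 for all $t\in\mathbb R^n$. Let $K_\nu(x)=\int_0^\infty e^{-x\cosh s}\cosh(\nu s)\,ds$ ($x>0$) be the modified Bessel function of the second kind, and take complex powers with the principal branch. If $\alpha\in(0,2)$, then the spectral density of $X$ is $$S_{\alpha,\beta}(\omega)=-\frac{\|\omega\|^{\frac{2-n}2}}{2^{\frac{n-2}2}\pi^{\frac{n+2}2}}\,\mathrm{Im}\int_0^\infty\frac{K_{\frac{n-2}2}(\|\omega\|u)}{\left(1+e^{i\pi\alpha/2}u^\alpha\right)^{\beta}}\,u^{\frac n2}\,du\qquad(\omega\neq0),$$ the integral being absolutely convergent for every $\omega\ne0$. If $\alpha=2$, then the spectral density of $X$ is $$S_{2,\beta}(\omega)=\frac{\|\omega\|^{\beta-\frac n2}}{2^{\frac n2+\beta-1}\pi^{\frac n2}\Gamma(\beta)}\,K_{\frac n2-\beta}(\|\omega\|)\qquad(\omega\neq0).$$ -/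

import Mathlib

open MeasureTheory ProbabilityTheory Filter Topology Set
open scoped SchwartzMap

noncomputable section

/-- A random field `X` on `ℝⁿ` is strictly stationary: its finite-dimensional distributions are
invariant under translations of the parameter. -/
def IsStationaryField {Ω : Type*} [MeasurableSpace Ω] {n : ℕ} (P : Measure Ω)
    (X : EuclideanSpace ℝ (Fin n) → Ω → ℝ) : Prop :=
  ∀ (h : EuclideanSpace ℝ (Fin n)) (I : Finset (EuclideanSpace ℝ (Fin n))),
    IdentDistrib (fun x (t : I) => X (t.1 + h) x) (fun x (t : I) => X t.1 x) P P

/-- `X` is a Gaussian field with generalized Cauchy covariance (GFGCC) on `ℝⁿ`: a stationary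
Gaussian field with mean zero and
`⟨X(t + τ) X(t)⟩ = (1 + ‖τ‖ ^ α) ^ (-β)`. -/
structure IsGFGCC {Ω : Type*} [MeasurableSpace Ω] {n : ℕ} (α β : ℝ) (P : Measure Ω)
    (X : EuclideanSpace ℝ (Fin n) → Ω → ℝ) : Prop where
  gaussian : IsGaussianProcess X P
  stationary : IsStationaryField P X
  mean_zero : ∀ t, ∫ x, X t x ∂P = 0
  covariance : ∀ t τ, ∫ x, X (t + τ) x * X t x ∂P = (1 + ‖τ‖ ^ α) ^ (-β)

/-- The covariance function `C(t) = ⟨X(t) X(0)⟩` of a centred stationary field. -/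
def covarianceFunction {Ω : Type*} [MeasurableSpace Ω] {n : ℕ} (P : Measure Ω)
    (X : EuclideanSpace ℝ (Fin n) → Ω → ℝ) (t : EuclideanSpace ℝ (Fin n)) : ℝ :=
  ∫ x, X t x * X 0 x ∂P

/-- The Fourier integral `(2π)⁻ⁿ ∫ exp(-i ω·t) C(t) dt` over `ℝⁿ` converges to `L`, as the limit
of the integrals over the balls `‖t‖ ≤ R` for `R → ∞`. -/
def FourierIntegralConvergesTo {n : ℕ} (C : EuclideanSpace ℝ (Fin n) → ℝ)
    (ω : EuclideanSpace ℝ (Fin n)) (L : ℂ) : Prop :=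
  Tendsto (fun R : ℝ => (((2 * Real.pi) ^ n : ℝ) : ℂ)⁻¹ *
    ∫ t in Metric.closedBall (0 : EuclideanSpace ℝ (Fin n)) R,
      Complex.exp (-Complex.I * (inner ℝ ω t : ℝ)) * (C t : ℂ)) atTop (𝓝 L)

/-- `ψ̂(t) = (2π)⁻ⁿ ∫ exp(-i ω·t) ψ(ω) dω`. -/
def schwartzHat {n : ℕ} (ψ : 𝓢(EuclideanSpace ℝ (Fin n), ℂ))
    (t : EuclideanSpace ℝ (Fin n)) : ℂ :=
  (((2 * Real.pi) ^ n : ℝ) : ℂ)⁻¹ *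
    ∫ ω, Complex.exp (-Complex.I * (inner ℝ ω t : ℝ)) * ψ ω

/-- `S`, a function on `ℝⁿ ∖ {0}` (the value at the origin, where it may be singular, plays no
role), is the spectral density belonging to the covariance function `C`, in each of the usual
senses:
* pointwise, wherever the Fourier integral of `C` converges, `S` is its value;
* as a tempered distribution, `S` is the Fourier transform of `C`: `⟨S, ψ⟩ = ⟨C, ψ̂⟩`;
* `S` is integrable and `C(t) = ∫ exp(i ω·t) S(ω) dω` for every `t`. -/
structure IsSpectralDensity {n : ℕ} (C S : EuclideanSpace ℝ (Fin n) → ℝ) : Prop where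
  pointwise : ∀ ω, ω ≠ 0 → ∀ L : ℂ, FourierIntegralConvergesTo C ω L → (S ω : ℂ) = L
  distributional : ∀ ψ : 𝓢(EuclideanSpace ℝ (Fin n), ℂ),
    Integrable (fun ω => (S ω : ℂ) * ψ ω) ∧
    Integrable (fun t => (C t : ℂ) * schwartzHat ψ t) ∧
    ∫ ω, (S ω : ℂ) * ψ ω = ∫ t, (C t : ℂ) * schwartzHat ψ t
  integrable : Integrable S
  inversion : ∀ t, (C t : ℂ) = ∫ ω, Complex.exp (Complex.I * (inner ℝ ω t : ℝ)) * (S ω : ℂ)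

/-- The modified Bessel function of the second kind `K_ν(x)`, for real order `ν` and `x > 0`, by
its integral representation `K_ν(x) = ∫₀^∞ exp(-x cosh s) cosh(ν s) ds`. -/
def besselK (ν x : ℝ) : ℝ :=
  ∫ s in Ioi (0 : ℝ), Real.exp (-x * Real.cosh s) * Real.cosh (ν * s)

/-- The integrand `K_{(n-2)/2}(r u) u^{n/2} (1 + exp(iπα/2) u^α)^{-β}`, with the principal branch
of the complex power. -/
def gfgccIntegrand (n : ℕ) (α β r u : ℝ) : ℂ :=
  ((besselK (((n : ℝ) - 2) / 2) (r * u) * u ^ ((n : ℝ) / 2) : ℝ) : ℂ) *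
    (1 + Complex.exp (Complex.I * Real.pi * α / 2) * ((u ^ α : ℝ) : ℂ)) ^ (-(β : ℂ))

end

/-! The covariance is a mixture of Gaussians, `C(t) = ∫ g(τ) exp(-τ‖t‖²) dτ` over `τ > 0`, with `g`
integrable but not assumed of one sign. Each Gaussian is the characteristic function of a heat
kernel, so the density must be the same mixture of heat kernels, `S(ω) = ∫ g(τ) heatDensity n τ ‖ω‖
dτ`. Fubini gives integrability and inversion, and from inversion the distributional identity.
Pointwise convergence is tested with Gaussian means: these tend to the value of the Fourier integral
wherever it converges (Abel summation), while on the mixture the factor `exp(-ε‖t‖²)` only shifts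
`τ` to `ε + τ`. This is `isSpectralDensity_of_gaussianMixture`.

It remains to find `g`. For `α = 2` it is the Gamma density. For `0 < α < 2` the function `F(z) = (1
+ z^α)^(-β)` is holomorphic in the right half-plane. Cauchy's theorem with kernel `z / (z² - x²)`
yields the Stieltjes representation `F(x) = (2/π) ∫ -Im F(iu) · u / (u² + x²) du`
(`integral_cauchyBoundary_im_mul_div`), and `1 / (u² + x²) = ∫ exp(-τ(u² + x²)) dτ` turns it into a
Gaussian mixture. Its weight is integrable because `Im F(iu) / u` is. Exchanging integrals once
more, the `τ`-integral of `exp(-τu²)` against the heat kernel is a Bessel function, which produces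
the stated formula. -/

/-! ### Exponential substitution and integrals for the Bessel function `K`. -/

theorem range_exp_image : Real.exp '' univ = Ioi 0 := by
  rw [image_univ, Real.range_exp]

theorem integral_Ioi_zero_eq_integral_comp_exp {E : Type*} [NormedAddCommGroup E]
    [NormedSpace ℝ E] (f : ℝ → E) :
    ∫ x in Ioi (0 : ℝ), f x = ∫ s : ℝ, Real.exp s • f (Real.exp s) := by
  have h := integral_image_eq_integral_abs_deriv_smul (f := Real.exp) (f' := Real.exp)
    MeasurableSet.univ (fun x _ => (Real.hasDerivAt_exp x).hasDerivWithinAt)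
    Real.exp_injective.injOn f
  rw [range_exp_image] at h
  simpa [abs_of_pos (Real.exp_pos _)] using h

theorem integrableOn_Ioi_zero_iff_integrable_comp_exp {E : Type*} [NormedAddCommGroup E]
    [NormedSpace ℝ E] (f : ℝ → E) :
    IntegrableOn f (Ioi (0 : ℝ)) ↔ Integrable (fun s : ℝ => Real.exp s • f (Real.exp s)) := by
  have h := integrableOn_image_iff_integrableOn_abs_deriv_smul (f := Real.exp) (f' := Real.exp)
    MeasurableSet.univ (fun x _ => (Real.hasDerivAt_exp x).hasDerivWithinAt)
    Real.exp_injective.injOn f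
  rw [range_exp_image] at h
  simpa [abs_of_pos (Real.exp_pos _)] using h

theorem one_add_sq_div_two_le_cosh (s : ℝ) : 1 + s ^ 2 / 2 ≤ Real.cosh s := by
  have h : Real.cosh s = 1 + 2 * Real.sinh (s / 2) ^ 2 := by
    conv_lhs => rw [show s = 2 * (s / 2) by ring, Real.cosh_two_mul, Real.cosh_sq]
    ring
  have h2 : |s / 2| ≤ |Real.sinh (s / 2)| := by
    rw [Real.abs_sinh]
    exact Real.self_le_sinh_iff.2 (abs_nonneg _)
  have h3 := sq_le_sq.2 h2
  rw [h]
  linarith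

theorem integrable_exp_mul_sub_mul_cosh (p : ℝ) {x : ℝ} (hx : 0 < x) :
    Integrable (fun s : ℝ => Real.exp (p * s - x * Real.cosh s)) := by
  -- Since `cosh s ≥ 1 + s²/2`, the integrand is dominated by a Gaussian.
  have h := (integrable_cexp_quadratic (b := ((x / 2 : ℝ) : ℂ)) (by simpa using hx) p (-x)).norm
  refine h.mono (by fun_prop) (ae_of_all _ fun s => ?_)
  rw [Complex.norm_exp, Real.norm_eq_abs, Real.norm_eq_abs, Real.abs_exp, Real.abs_exp]
  have hre : (-((x / 2 : ℝ) : ℂ) * (s : ℂ) ^ 2 + p * s + -(x : ℂ)).re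
      = -(x / 2) * s ^ 2 + p * s - x := by
    rw [show (-((x / 2 : ℝ) : ℂ) * (s : ℂ) ^ 2 + p * s + -(x : ℂ))
      = ((-(x / 2) * s ^ 2 + p * s - x : ℝ) : ℂ) by push_cast; ring, Complex.ofReal_re]
  rw [hre]
  refine Real.exp_le_exp.2 ?_
  have h1 := one_add_sq_div_two_le_cosh s
  nlinarith

theorem besselK_neg (ν x : ℝ) : besselK (-ν) x = besselK ν x := by
  simp [besselK]

theorem integral_exp_mul_sub_mul_cosh (p : ℝ) {x : ℝ} (hx : 0 < x) :
    ∫ s : ℝ, Real.exp (p * s - x * Real.cosh s) = 2 * besselK p x := by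
  have hi := integrable_exp_mul_sub_mul_cosh p hx
  have hn := integral_neg_eq_self (fun s : ℝ => Real.exp (p * s - x * Real.cosh s)) volume
  have hi' : Integrable (fun s : ℝ => Real.exp (p * (-s) - x * Real.cosh (-s))) := hi.comp_neg
  have hadd := integral_add hi hi'
  have habs := integral_comp_abs (f := fun s : ℝ => Real.exp (-x * Real.cosh s) * Real.cosh (p * s))
  have hpt : ∀ s : ℝ, Real.exp (-x * Real.cosh |s|) * Real.cosh (p * |s|)
      = (Real.exp (p * s - x * Real.cosh s) + Real.exp (p * (-s) - x * Real.cosh (-s))) / 2 := by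
    intro s
    have : Real.cosh (p * |s|) = Real.cosh (p * s) := by
      rw [← Real.cosh_abs (p * |s|), ← Real.cosh_abs (p * s), abs_mul, abs_mul, abs_abs]
    rw [this, Real.cosh_abs, Real.cosh_neg, Real.cosh_eq (p * s), sub_eq_add_neg, sub_eq_add_neg,
      Real.exp_add, Real.exp_add]
    ring_nf
  simp only [hpt, integral_div] at habs
  rw [besselK]
  linarith

theorem exp_smul_comp_exp_eq (p : ℝ) {c : ℝ} (hc : 0 < c) (x s : ℝ) :
    Real.exp s • ((c * Real.exp s) ^ (p - 1) *
        Real.exp (-(x / 2 * (c * Real.exp s / c + c / (c * Real.exp s))))) =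
      c ^ (p - 1) * Real.exp (p * s - x * Real.cosh s) := by
  rw [Real.mul_rpow hc.le (Real.exp_pos _).le, ← Real.exp_mul, Real.cosh_eq,
    mul_div_cancel_left₀ _ hc.ne', div_mul_eq_div_div, div_self hc.ne', one_div, ← Real.exp_neg,
    smul_eq_mul]
  rw [show ∀ A B C D : ℝ, A * (B * C * D) = B * (A * C * D) by intros; ring, ← Real.exp_add,
    ← Real.exp_add]
  congr 2
  ring

/-- Put `τ = c e^s`: then `τ/c + c/τ = 2 cosh s`, and `dτ/τ = ds`. -/
theorem integral_rpow_mul_exp_eq_besselK (p : ℝ) {c x : ℝ} (hc : 0 < c) (hx : 0 < x) :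
    ∫ τ in Ioi (0 : ℝ), τ ^ (p - 1) * Real.exp (-(x / 2 * (τ / c + c / τ))) =
      2 * c ^ p * besselK p x := by
  have h := integral_comp_mul_left_Ioi
    (fun τ : ℝ => τ ^ (p - 1) * Real.exp (-(x / 2 * (τ / c + c / τ)))) 0 hc
  rw [mul_zero, integral_Ioi_zero_eq_integral_comp_exp] at h
  simp only [exp_smul_comp_exp_eq p hc, integral_const_mul] at h
  rw [integral_exp_mul_sub_mul_cosh p hx, smul_eq_mul, inv_mul_eq_div, eq_div_iff hc.ne'] at h
  rw [← h, Real.rpow_sub_one hc.ne']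
  field_simp

/-! ### The heat kernel as a function of time and its bounds. -/

/-- The heat kernel `(4πτ)^(-n/2) exp(-r²/(4τ))` on `ℝⁿ`, as a function of time and radius. -/
noncomputable def heatDensity (n : ℕ) (τ r : ℝ) : ℝ :=
  (4 * Real.pi * τ) ^ (-((n : ℝ) / 2)) * Real.exp (-(r ^ 2 / (4 * τ)))

theorem measurable_heatDensity (n : ℕ) : Measurable fun p : ℝ × ℝ => heatDensity n p.1 p.2 := by
  unfold heatDensity
  fun_prop

theorem heatDensity_nonneg (n : ℕ) {τ : ℝ} (hτ : 0 < τ) (r : ℝ) : 0 ≤ heatDensity n τ r := by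
  unfold heatDensity
  positivity

theorem continuousAt_heatDensity (n : ℕ) {τ : ℝ} (hτ : 0 < τ) (r : ℝ) :
    ContinuousAt (fun s => heatDensity n s r) τ := by
  unfold heatDensity
  refine ContinuousAt.mul (ContinuousAt.rpow_const (by fun_prop) (Or.inl (by positivity))) ?_
  refine Real.continuous_exp.continuousAt.comp (ContinuousAt.neg (ContinuousAt.div ?_ ?_ ?_))
  · fun_prop
  · fun_prop
  · positivity

/-- Raise `x ≤ e^x` at `x = cy/p` to the power `p`. -/
theorem rpow_mul_exp_neg_le {p c y : ℝ} (hp : 0 < p) (hc : 0 < c) (hy : 0 ≤ y) :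
    y ^ p * Real.exp (-(c * y)) ≤ (p / c) ^ p := by
  have h1 : (c * y / p) ≤ Real.exp (c * y / p) := by
    linarith [Real.add_one_le_exp (c * y / p)]
  have h2 : (c * y / p) ^ p ≤ Real.exp (c * y) := by
    refine (Real.rpow_le_rpow (by positivity) h1 hp.le).trans_eq ?_
    rw [← Real.exp_mul, div_mul_cancel₀ _ hp.ne']
  have h3 : y ^ p = (p / c) ^ p * (c * y / p) ^ p := by
    rw [← Real.mul_rpow (by positivity) (by positivity)]
    congr 1
    field_simp
  rw [h3, mul_assoc]
  refine mul_le_of_le_one_right (by positivity) ?_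
  rw [Real.exp_neg, ← div_eq_mul_inv, div_le_one (Real.exp_pos _)]
  exact h2

theorem exists_heatDensity_le {n : ℕ} (hn : 1 ≤ n) {r : ℝ} (hr : r ≠ 0) :
    ∃ M, ∀ τ, 0 < τ → heatDensity n τ r ≤ M := by
  have hn' : (0 : ℝ) < (n : ℝ) / 2 := by positivity
  have hr2 : 0 < r ^ 2 * Real.pi := by positivity
  refine ⟨((n : ℝ) / 2 / (r ^ 2 * Real.pi)) ^ ((n : ℝ) / 2), fun τ hτ => ?_⟩
  -- In the variable `y = 1/(4πτ)` the heat kernel is `y^(n/2) exp(-πr²y)`, bounded because `r ≠ 0`.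
  have h := rpow_mul_exp_neg_le hn' hr2 (y := (4 * Real.pi * τ)⁻¹) (by positivity)
  rw [Real.inv_rpow (by positivity), ← Real.rpow_neg (by positivity)] at h
  have e : r ^ 2 * Real.pi * (4 * Real.pi * τ)⁻¹ = r ^ 2 / (4 * τ) := by
    field_simp
  rwa [e] at h

/-! ### Fourier transforms of Gaussians and heat kernels. -/

section Fourier

variable {n : ℕ}

theorem integrable_exp_inner_mul_heatDensity {τ : ℝ} (hτ : 0 < τ)
    (t : EuclideanSpace ℝ (Fin n)) :
    Integrable (fun ω : EuclideanSpace ℝ (Fin n) =>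
      Complex.exp (Complex.I * (inner ℝ ω t : ℝ)) * (heatDensity n τ ‖ω‖ : ℂ)) ∧
    ∫ ω : EuclideanSpace ℝ (Fin n),
      Complex.exp (Complex.I * (inner ℝ ω t : ℝ)) * (heatDensity n τ ‖ω‖ : ℂ) =
        (Real.exp (-(τ * ‖t‖ ^ 2)) : ℂ) := by
  have hb : 0 < (((4 * τ)⁻¹ : ℝ) : ℂ).re := by rw [Complex.ofReal_re]; positivity
  have h1 := GaussianFourier.integrable_cexp_neg_mul_sq_norm_add hb Complex.I t
  have h2 := GaussianFourier.integral_cexp_neg_mul_sq_norm_add hb Complex.I t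
  have hpt : (fun ω : EuclideanSpace ℝ (Fin n) =>
      Complex.exp (Complex.I * (inner ℝ ω t : ℝ)) * (heatDensity n τ ‖ω‖ : ℂ)) =
      fun ω => (((4 * Real.pi * τ) ^ (-((n : ℝ) / 2)) : ℝ) : ℂ) *
        Complex.exp (-(((4 * τ)⁻¹ : ℝ) : ℂ) * (‖ω‖ : ℂ) ^ 2 + Complex.I * (inner ℝ t ω : ℝ)) := by
    ext ω
    rw [heatDensity, real_inner_comm, Complex.exp_add]
    push_cast
    rw [show -((‖ω‖ : ℂ) ^ 2 / (4 * (τ : ℂ))) = -(4 * (τ : ℂ))⁻¹ * (‖ω‖ : ℂ) ^ 2 by ring]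
    ring
  rw [hpt]
  refine ⟨h1.const_mul _, ?_⟩
  rw [integral_const_mul, h2, finrank_euclideanSpace, Fintype.card_fin]
  have e1 : ((Real.pi : ℂ) / (((4 * τ)⁻¹ : ℝ) : ℂ)) = ((4 * Real.pi * τ : ℝ) : ℂ) := by
    push_cast; rw [div_inv_eq_mul]; ring
  have e2 : Complex.I ^ 2 * (‖t‖ : ℂ) ^ 2 / (4 * (((4 * τ)⁻¹ : ℝ) : ℂ))
      = ((-(τ * ‖t‖ ^ 2) : ℝ) : ℂ) := by
    have : (τ : ℂ) ≠ 0 := by exact_mod_cast hτ.ne'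
    rw [Complex.I_sq]; push_cast; field_simp
  have e3 : (((4 * Real.pi * τ : ℝ) : ℂ)) ^ ((n : ℂ) / 2) =
      (((4 * Real.pi * τ) ^ ((n : ℝ) / 2) : ℝ) : ℂ) := by
    rw [Complex.ofReal_cpow (by positivity)]; push_cast; rfl
  rw [e1, e2, e3, ← mul_assoc, ← Complex.ofReal_mul, ← Real.rpow_add (by positivity),
    ← Complex.ofReal_exp]
  simp

theorem integrable_heatDensity {τ : ℝ} (hτ : 0 < τ) :
    Integrable (fun ω : EuclideanSpace ℝ (Fin n) => heatDensity n τ ‖ω‖) ∧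
    ∫ ω : EuclideanSpace ℝ (Fin n), heatDensity n τ ‖ω‖ = 1 := by
  obtain ⟨h1, h2⟩ := integrable_exp_inner_mul_heatDensity hτ (0 : EuclideanSpace ℝ (Fin n))
  simp only [inner_zero_right, Complex.ofReal_zero, mul_zero, Complex.exp_zero, one_mul] at h1 h2
  refine ⟨by simpa using h1.re, ?_⟩
  rw [integral_complex_ofReal] at h2
  rw [← Complex.ofReal_inj, h2]
  simp

theorem integral_exp_neg_inner_mul_gaussian {s : ℝ} (hs : 0 < s)
    (ω : EuclideanSpace ℝ (Fin n)) :
    ∫ t : EuclideanSpace ℝ (Fin n),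
      Complex.exp (-Complex.I * (inner ℝ ω t : ℝ)) * (Real.exp (-(s * ‖t‖ ^ 2)) : ℂ) =
        (((2 * Real.pi) ^ n : ℝ) : ℂ) * (heatDensity n s ‖ω‖ : ℂ) := by
  have hb : 0 < ((s : ℝ) : ℂ).re := by simpa using hs
  have h2 := GaussianFourier.integral_cexp_neg_mul_sq_norm_add hb (-Complex.I) ω
  have hpt : (fun t : EuclideanSpace ℝ (Fin n) =>
      Complex.exp (-Complex.I * (inner ℝ ω t : ℝ)) * (Real.exp (-(s * ‖t‖ ^ 2)) : ℂ)) =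
      fun t => Complex.exp (-(s : ℂ) * (‖t‖ : ℂ) ^ 2 + -Complex.I * (inner ℝ ω t : ℝ)) := by
    ext t
    rw [Complex.exp_add, mul_comm]
    push_cast
    rw [neg_mul (s : ℂ)]
  rw [hpt, h2, finrank_euclideanSpace, Fintype.card_fin, heatDensity]
  have e1 : ((Real.pi : ℂ) / (s : ℂ)) ^ ((n : ℂ) / 2) =
      (((Real.pi / s) ^ ((n : ℝ) / 2) : ℝ) : ℂ) := by
    rw [Complex.ofReal_cpow (by positivity)]; push_cast; rfl
  have e2 : (-Complex.I) ^ 2 * (‖ω‖ : ℂ) ^ 2 / (4 * (s : ℂ)) =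
      ((-(‖ω‖ ^ 2 / (4 * s)) : ℝ) : ℂ) := by
    rw [neg_sq, Complex.I_sq]; push_cast; ring
  have e3 : (Real.pi / s) ^ ((n : ℝ) / 2) =
      (2 * Real.pi) ^ n * (4 * Real.pi * s) ^ (-((n : ℝ) / 2)) := by
    have hpos : (0 : ℝ) < 4 * Real.pi * s := by positivity
    rw [Real.rpow_neg hpos.le, ← div_eq_mul_inv, eq_div_iff (by positivity),
      ← Real.mul_rpow (by positivity) hpos.le,
      show Real.pi / s * (4 * Real.pi * s) = (2 * Real.pi) ^ (2 : ℝ) by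
        rw [Real.rpow_two]; field_simp; ring,
      ← Real.rpow_mul (by positivity), mul_div_cancel₀ _ two_ne_zero, Real.rpow_natCast]
  rw [e1, e2, e3, ← Complex.ofReal_exp]
  push_cast
  ring

theorem integrable_exp_neg_mul_sq_norm {ε : ℝ} (hε : 0 < ε) :
    Integrable (fun t : EuclideanSpace ℝ (Fin n) => Real.exp (-(ε * ‖t‖ ^ 2))) := by
  have h := (GaussianFourier.integrable_cexp_neg_mul_sq_norm_add (b := (ε : ℂ)) (by simpa using hε)
    0 (0 : EuclideanSpace ℝ (Fin n))).re
  refine h.congr (ae_of_all _ fun t => ?_)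
  simp only [zero_mul, add_zero]
  rw [show -(ε : ℂ) * (‖t‖ : ℂ) ^ 2 = ((-(ε * ‖t‖ ^ 2) : ℝ) : ℂ) by push_cast; ring,
    ← Complex.ofReal_exp]
  rfl

end Fourier

/-! ### Abel summation with Gaussian weights. -/

theorem mem_closedBall_sqrt_div_iff {V : Type*} [SeminormedAddCommGroup V] {ε y : ℝ} (hε : 0 < ε)
    (hy : 0 ≤ y) (t : V) : t ∈ Metric.closedBall (0 : V) (√(y / ε)) ↔ ε * ‖t‖ ^ 2 ≤ y := by
  rw [mem_closedBall_zero_iff, mul_comm, ← le_div_iff₀ hε]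
  exact Real.le_sqrt (norm_nonneg t) (div_nonneg hy hε.le)

section Abel

variable {n : ℕ} {f : EuclideanSpace ℝ (Fin n) → ℂ} {B : ℝ}

theorem integral_Ici_indicator_exp_neg {a : ℝ} (ha : 0 ≤ a) :
    ∫ y in Ioi (0 : ℝ), (Ici a).indicator (fun y => Real.exp (-y)) y = Real.exp (-a) := by
  have h := integral_Ici_eq_integral_Ioi (μ := volume) (x := (0 : ℝ))
    (f := (Ici a).indicator fun y => Real.exp (-y))
  rw [← h, setIntegral_indicator measurableSet_Ici, Ici_inter_Ici,
    sup_eq_right.2 ha, integral_Ici_eq_integral_Ioi, integral_exp_neg_Ioi]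

theorem integrable_indicator_exp_neg_mul (hfm : AEStronglyMeasurable f)
    (hB : ∀ t, ‖f t‖ ≤ B) {ε : ℝ} (hε : 0 < ε) :
    Integrable (fun p : EuclideanSpace ℝ (Fin n) × ℝ =>
      (((Ici (ε * ‖p.1‖ ^ 2)).indicator (fun y => Real.exp (-y)) p.2 : ℝ) : ℂ) * f p.1)
      (volume.prod (volume.restrict (Ioi 0))) := by
  have hmeas : Measurable fun p : EuclideanSpace ℝ (Fin n) × ℝ =>
      (Ici (ε * ‖p.1‖ ^ 2)).indicator (fun y => Real.exp (-y)) p.2 := by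
    have hset : MeasurableSet {p : EuclideanSpace ℝ (Fin n) × ℝ | ε * ‖p.1‖ ^ 2 ≤ p.2} :=
      measurableSet_le (by fun_prop) (by fun_prop)
    exact Measurable.indicator (f := fun p : EuclideanSpace ℝ (Fin n) × ℝ => Real.exp (-p.2))
      (by fun_prop) hset
  have hexp : IntegrableOn (fun y : ℝ => Real.exp (-y)) (Ioi 0) := integrableOn_exp_neg_Ioi 0
  have hint : ∀ t : EuclideanSpace ℝ (Fin n), Integrable
      ((Ici (ε * ‖t‖ ^ 2)).indicator (fun y => Real.exp (-y))) (volume.restrict (Ioi 0)) :=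
    fun t => hexp.indicator measurableSet_Ici
  have hm : AEStronglyMeasurable (fun p : EuclideanSpace ℝ (Fin n) × ℝ =>
      (((Ici (ε * ‖p.1‖ ^ 2)).indicator (fun y => Real.exp (-y)) p.2 : ℝ) : ℂ) * f p.1)
      (volume.prod (volume.restrict (Ioi 0))) :=
    (Complex.measurable_ofReal.comp hmeas).aestronglyMeasurable.mul hfm.comp_fst
  rw [integrable_prod_iff hm]
  refine ⟨ae_of_all _ fun t => (hint t).ofReal.mul_const (f t), ?_⟩
  have heq : ∀ t : EuclideanSpace ℝ (Fin n), ∫ y in Ioi (0 : ℝ),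
      ‖(((Ici (ε * ‖t‖ ^ 2)).indicator (fun y => Real.exp (-y)) y : ℝ) : ℂ) * f t‖ =
      Real.exp (-(ε * ‖t‖ ^ 2)) * ‖f t‖ := by
    intro t
    rw [← integral_Ici_indicator_exp_neg (by positivity : 0 ≤ ε * ‖t‖ ^ 2), ← integral_mul_const]
    congr 1
    ext y
    rw [norm_mul, Complex.norm_real, Real.norm_of_nonneg]
    exact indicator_nonneg (fun _ _ => (Real.exp_pos _).le) _
  simp only [heq]
  exact (integrable_exp_neg_mul_sq_norm hε).mul_bdd (c := B) hfm.norm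
    (ae_of_all _ fun t => by simpa using hB t)

/-- Layer-cake: write `exp(-ε‖t‖²)` as the integral of `e^(-y)` over `y ≥ ε‖t‖²` and swap the
integrals. The Gaussian mean becomes an average of ball integrals, to which dominated convergence
applies. -/
theorem integral_exp_neg_mul_sq_norm_mul_eq (hfm : AEStronglyMeasurable f)
    (hB : ∀ t, ‖f t‖ ≤ B) {ε : ℝ} (hε : 0 < ε) :
    IntegrableOn (fun y : ℝ => (Real.exp (-y) : ℂ) *
      ∫ t in Metric.closedBall (0 : EuclideanSpace ℝ (Fin n)) (√(y / ε)), f t) (Ioi 0) ∧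
    ∫ t, (Real.exp (-(ε * ‖t‖ ^ 2)) : ℂ) * f t = ∫ y in Ioi (0 : ℝ), (Real.exp (-y) : ℂ) *
      ∫ t in Metric.closedBall (0 : EuclideanSpace ℝ (Fin n)) (√(y / ε)), f t := by
  have hint := integrable_indicator_exp_neg_mul hfm hB hε
  have hfub := integral_integral_swap (f := fun (t : EuclideanSpace ℝ (Fin n)) (y : ℝ) =>
    (((Ici (ε * ‖t‖ ^ 2)).indicator (fun y => Real.exp (-y)) y : ℝ) : ℂ) * f t) hint
  have hae : ∀ y : ℝ, 0 < y → ∫ t : EuclideanSpace ℝ (Fin n),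
      (((Ici (ε * ‖t‖ ^ 2)).indicator (fun y => Real.exp (-y)) y : ℝ) : ℂ) * f t =
      (Real.exp (-y) : ℂ) *
        ∫ t in Metric.closedBall (0 : EuclideanSpace ℝ (Fin n)) (√(y / ε)), f t := by
    intro y hy
    rw [← integral_const_mul, ← integral_indicator Metric.isClosed_closedBall.measurableSet]
    congr 1
    ext t
    by_cases ht : ε * ‖t‖ ^ 2 ≤ y
    · rw [indicator_of_mem (mem_Ici.2 ht),
        indicator_of_mem ((mem_closedBall_sqrt_div_iff hε hy.le t).2 ht)]
    · rw [indicator_of_notMem (by simpa using ht),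
        indicator_of_notMem (fun h => ht ((mem_closedBall_sqrt_div_iff hε hy.le t).1 h))]
      simp
  refine ⟨hint.integral_prod_right.congr ?_, ?_⟩
  · filter_upwards [ae_restrict_mem measurableSet_Ioi] with y hy
    exact hae y hy
  · rw [← setIntegral_congr_fun measurableSet_Ioi hae, ← hfub]
    congr 1
    ext t
    rw [integral_mul_const, integral_complex_ofReal,
      integral_Ici_indicator_exp_neg (by positivity : 0 ≤ ε * ‖t‖ ^ 2)]

/-- Abel summation: Gaussian means of a bounded function whose integrals over balls converge
tend to the same limit. -/
theorem tendsto_integral_exp_neg_mul_sq_norm_mul (hfm : AEStronglyMeasurable f)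
    (hB : ∀ t, ‖f t‖ ≤ B) {L : ℂ}
    (hL : Tendsto (fun R : ℝ => ∫ t in Metric.closedBall (0 : EuclideanSpace ℝ (Fin n)) R, f t)
      atTop (𝓝 L)) :
    Tendsto (fun ε : ℝ => ∫ t, (Real.exp (-(ε * ‖t‖ ^ 2)) : ℂ) * f t) (𝓝[>] 0) (𝓝 L) := by
  -- Ball integrals are bounded uniformly in `R`: beyond some `R₀` by convergence, below it by `B`
  -- times the volume of the ball of radius `R₀`.
  obtain ⟨M, hM⟩ : ∃ M, ∀ R : ℝ,
      ‖∫ t in Metric.closedBall (0 : EuclideanSpace ℝ (Fin n)) R, f t‖ ≤ M := by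
    obtain ⟨R₀, hR₀⟩ := eventually_atTop.1 (hL.norm.eventually_le_const (lt_add_one ‖L‖))
    refine ⟨max (‖L‖ + 1)
      (B * volume.real (Metric.closedBall (0 : EuclideanSpace ℝ (Fin n)) R₀)), fun R => ?_⟩
    rcases le_total R₀ R with h | h
    · exact (hR₀ R h).trans (le_max_left _ _)
    · refine le_trans ?_ (le_max_right _ _)
      have hB0 : 0 ≤ B := (norm_nonneg _).trans (hB 0)
      refine (norm_setIntegral_le_of_norm_le_const
        measure_closedBall_lt_top (fun t _ => hB t)).trans ?_
      exact mul_le_mul_of_nonneg_left (measureReal_mono (Metric.closedBall_subset_closedBall h)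
        measure_closedBall_lt_top.ne) hB0
  have hexp : IntegrableOn (fun y : ℝ => Real.exp (-y)) (Ioi 0) := integrableOn_exp_neg_Ioi 0
  have hlim : Tendsto (fun ε : ℝ => ∫ y in Ioi (0 : ℝ), (Real.exp (-y) : ℂ) *
      ∫ t in Metric.closedBall (0 : EuclideanSpace ℝ (Fin n)) (√(y / ε)), f t) (𝓝[>] 0)
      (𝓝 (∫ y in Ioi (0 : ℝ), (Real.exp (-y) : ℂ) * L)) := by
    refine tendsto_integral_filter_of_dominated_convergence (fun y => Real.exp (-y) * M) ?_ ?_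
      (hexp.mul_const M) ?_
    · filter_upwards [self_mem_nhdsWithin] with ε hε
      exact (integral_exp_neg_mul_sq_norm_mul_eq hfm hB hε).1.aestronglyMeasurable
    · refine Eventually.of_forall fun ε => ae_of_all _ fun y => ?_
      rw [norm_mul, Complex.norm_real, Real.norm_of_nonneg (Real.exp_pos _).le]
      exact mul_le_mul_of_nonneg_left (hM _) (Real.exp_pos _).le
    · filter_upwards [ae_restrict_mem measurableSet_Ioi] with y hy
      refine (hL.comp (Real.tendsto_sqrt_atTop.comp ?_)).const_mul _
      exact (tendsto_inv_nhdsGT_zero.const_mul_atTop (mem_Ioi.1 hy)).congr fun ε => by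
        rw [div_eq_mul_inv]
  have h1 : ∫ y in Ioi (0 : ℝ), (Real.exp (-y) : ℂ) * L = L := by
    rw [integral_mul_const, integral_complex_ofReal, integral_exp_neg_Ioi_zero]
    simp
  rw [h1] at hlim
  refine hlim.congr' ?_
  filter_upwards [self_mem_nhdsWithin] with ε hε
  exact (integral_exp_neg_mul_sq_norm_mul_eq hfm hB hε).2.symm

end Abel

/-! ### Mixtures of heat kernels and of Gaussians. -/

section Mixture

variable {n : ℕ} {g : ℝ → ℝ}

/-- Each heat kernel has total mass one, so integrating in space first leaves `|g|`. -/
theorem integrable_heatDensity_mul (hg : IntegrableOn g (Ioi 0)) :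
    Integrable (fun p : EuclideanSpace ℝ (Fin n) × ℝ => g p.2 * heatDensity n p.2 ‖p.1‖)
      (volume.prod (volume.restrict (Ioi 0))) := by
  have hm : AEStronglyMeasurable
      (fun p : EuclideanSpace ℝ (Fin n) × ℝ => g p.2 * heatDensity n p.2 ‖p.1‖)
      (volume.prod (volume.restrict (Ioi 0))) :=
    hg.aestronglyMeasurable.comp_snd.mul ((measurable_heatDensity n).comp
      (measurable_snd.prodMk measurable_fst.norm)).aestronglyMeasurable
  rw [integrable_prod_iff' hm]
  constructor
  · filter_upwards [ae_restrict_mem measurableSet_Ioi] with τ hτ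
    exact (integrable_heatDensity hτ).1.const_mul _
  · refine hg.norm.congr ?_
    filter_upwards [ae_restrict_mem measurableSet_Ioi] with τ hτ
    simp only [norm_mul, Real.norm_of_nonneg (heatDensity_nonneg n hτ _)]
    rw [integral_const_mul, (integrable_heatDensity hτ).2, mul_one]

theorem integrable_heatMixture (hg : IntegrableOn g (Ioi 0)) :
    Integrable (fun ω : EuclideanSpace ℝ (Fin n) =>
      ∫ τ in Ioi (0 : ℝ), g τ * heatDensity n τ ‖ω‖) :=
  (integrable_heatDensity_mul hg).integral_prod_left

theorem integral_exp_inner_mul_heatMixture (hg : IntegrableOn g (Ioi 0))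
    (t : EuclideanSpace ℝ (Fin n)) :
    ∫ ω : EuclideanSpace ℝ (Fin n), Complex.exp (Complex.I * (inner ℝ ω t : ℝ)) *
        ((∫ τ in Ioi (0 : ℝ), g τ * heatDensity n τ ‖ω‖ : ℝ) : ℂ) =
      ((∫ τ in Ioi (0 : ℝ), g τ * Real.exp (-(τ * ‖t‖ ^ 2)) : ℝ) : ℂ) := by
  have hint : Integrable (fun p : EuclideanSpace ℝ (Fin n) × ℝ =>
      Complex.exp (Complex.I * (inner ℝ p.1 t : ℝ)) * ((g p.2 * heatDensity n p.2 ‖p.1‖ : ℝ) : ℂ))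
      (volume.prod (volume.restrict (Ioi 0))) := by
    refine (integrable_heatDensity_mul hg).ofReal.bdd_mul (c := 1) ?_ (ae_of_all _ fun p => ?_)
    · exact Continuous.aestronglyMeasurable (by fun_prop)
    · rw [mul_comm, Complex.norm_exp_ofReal_mul_I]
  have hfub := integral_integral_swap (f := fun (ω : EuclideanSpace ℝ (Fin n)) (τ : ℝ) =>
    Complex.exp (Complex.I * (inner ℝ ω t : ℝ)) * ((g τ * heatDensity n τ ‖ω‖ : ℝ) : ℂ)) hint
  simp only [integral_const_mul, integral_complex_ofReal] at hfub
  rw [hfub, ← integral_complex_ofReal]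
  refine setIntegral_congr_fun measurableSet_Ioi fun τ hτ => ?_
  rw [Complex.ofReal_mul, ← (integrable_exp_inner_mul_heatDensity hτ t).2, ← integral_const_mul]
  congr 1
  ext ω
  push_cast
  ring

/-- The factor `exp(-ε‖t‖²)` makes the double integral absolutely convergent and combines with
`exp(-τ‖t‖²)` into a Gaussian of parameter `ε + τ`. -/
theorem integral_gaussian_mul_laplace (hg : IntegrableOn g (Ioi 0)) {ε : ℝ} (hε : 0 < ε)
    (ω : EuclideanSpace ℝ (Fin n)) :
    ∫ t : EuclideanSpace ℝ (Fin n), (Real.exp (-(ε * ‖t‖ ^ 2)) : ℂ) *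
        (Complex.exp (-Complex.I * (inner ℝ ω t : ℝ)) *
          ((∫ τ in Ioi (0 : ℝ), g τ * Real.exp (-(τ * ‖t‖ ^ 2)) : ℝ) : ℂ)) =
      (((2 * Real.pi) ^ n : ℝ) : ℂ) *
        ((∫ τ in Ioi (0 : ℝ), g τ * heatDensity n (ε + τ) ‖ω‖ : ℝ) : ℂ) := by
  have hint : Integrable (fun p : EuclideanSpace ℝ (Fin n) × ℝ =>
      Complex.exp (-Complex.I * (inner ℝ ω p.1 : ℝ)) *
        ((Real.exp (-(ε * ‖p.1‖ ^ 2)) * g p.2 : ℝ) : ℂ) * (Real.exp (-(p.2 * ‖p.1‖ ^ 2)) : ℂ))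
      (volume.prod (volume.restrict (Ioi 0))) := by
    refine Integrable.mul_bdd (c := 1) (Integrable.bdd_mul (c := 1)
      ((integrable_exp_neg_mul_sq_norm hε).mul_prod hg).ofReal ?_ (ae_of_all _ fun p => ?_)) ?_ ?_
    · exact Continuous.aestronglyMeasurable (by fun_prop)
    · rw [neg_mul, ← mul_neg, mul_comm, ← Complex.ofReal_neg, Complex.norm_exp_ofReal_mul_I]
    · exact Continuous.aestronglyMeasurable (by fun_prop)
    · have : ∀ᵐ p : EuclideanSpace ℝ (Fin n) × ℝ ∂(volume.prod (volume.restrict (Ioi 0))),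
          p.2 ∈ Ioi (0 : ℝ) :=
        Measure.quasiMeasurePreserving_snd.ae (ae_restrict_mem measurableSet_Ioi)
      filter_upwards [this] with p hp
      have hp' : (0 : ℝ) < p.2 := hp
      rw [Complex.norm_real, Real.norm_of_nonneg (Real.exp_pos _).le, Real.exp_le_one_iff]
      have : 0 ≤ p.2 * ‖p.1‖ ^ 2 := by positivity
      linarith
  have hfub := integral_integral_swap (f := fun (t : EuclideanSpace ℝ (Fin n)) (τ : ℝ) =>
      Complex.exp (-Complex.I * (inner ℝ ω t : ℝ)) *
        ((Real.exp (-(ε * ‖t‖ ^ 2)) * g τ : ℝ) : ℂ) * (Real.exp (-(τ * ‖t‖ ^ 2)) : ℂ)) hint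
  have hl : ∀ t : EuclideanSpace ℝ (Fin n), (Real.exp (-(ε * ‖t‖ ^ 2)) : ℂ) *
        (Complex.exp (-Complex.I * (inner ℝ ω t : ℝ)) *
          ((∫ τ in Ioi (0 : ℝ), g τ * Real.exp (-(τ * ‖t‖ ^ 2)) : ℝ) : ℂ)) =
      ∫ τ in Ioi (0 : ℝ), Complex.exp (-Complex.I * (inner ℝ ω t : ℝ)) *
        ((Real.exp (-(ε * ‖t‖ ^ 2)) * g τ : ℝ) : ℂ) * (Real.exp (-(τ * ‖t‖ ^ 2)) : ℂ) := by
    intro t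
    rw [← integral_complex_ofReal, ← integral_const_mul, ← integral_const_mul]
    congr 1
    ext τ
    push_cast
    ring
  simp only [hl]
  rw [hfub, ← integral_complex_ofReal, ← integral_const_mul]
  refine setIntegral_congr_fun measurableSet_Ioi fun τ hτ => ?_
  have hτ' : (0 : ℝ) < τ := hτ
  have h := integral_exp_neg_inner_mul_gaussian (add_pos hε hτ') ω
  rw [Complex.ofReal_mul, ← mul_assoc, mul_comm _ (g τ : ℂ), mul_assoc, ← h, ← integral_const_mul]
  congr 1
  ext t
  rw [add_mul, neg_add, Real.exp_add]
  push_cast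
  ring

/-- Away from `r = 0` the heat kernel is bounded uniformly in time, so a multiple of `|g|`
dominates. -/
theorem tendsto_integral_mul_heatDensity_add (hn : 1 ≤ n) (hg : IntegrableOn g (Ioi 0)) {r : ℝ}
    (hr : r ≠ 0) :
    Tendsto (fun ε : ℝ => ∫ τ in Ioi (0 : ℝ), g τ * heatDensity n (ε + τ) r) (𝓝[>] 0)
      (𝓝 (∫ τ in Ioi (0 : ℝ), g τ * heatDensity n τ r)) := by
  obtain ⟨M, hM⟩ := exists_heatDensity_le hn hr
  refine tendsto_integral_filter_of_dominated_convergence (fun τ => ‖g τ‖ * M) ?_ ?_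
    (hg.norm.mul_const M) ?_
  · refine Eventually.of_forall fun ε => hg.aestronglyMeasurable.mul ?_
    exact ((measurable_heatDensity n).comp
      ((measurable_const_add ε).prodMk measurable_const)).aestronglyMeasurable
  · filter_upwards [self_mem_nhdsWithin] with ε hε
    filter_upwards [ae_restrict_mem measurableSet_Ioi] with τ hτ
    have h : 0 < ε + τ := add_pos hε hτ
    rw [norm_mul, Real.norm_of_nonneg (heatDensity_nonneg n h r)]
    exact mul_le_mul_of_nonneg_left (hM _ h) (norm_nonneg _)
  · filter_upwards [ae_restrict_mem measurableSet_Ioi] with τ hτ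
    refine Tendsto.const_mul _ ?_
    have h1 : Tendsto (fun ε : ℝ => ε + τ) (𝓝[>] 0) (𝓝 τ) := by
      have : Tendsto (fun ε : ℝ => ε + τ) (𝓝 0) (𝓝 (0 + τ)) := tendsto_id.add_const τ
      rw [zero_add] at this
      exact this.mono_left nhdsWithin_le_nhds
    exact (continuousAt_heatDensity n hτ r).tendsto.comp h1

end Mixture

/-! ### Fourier inversion for Schwartz functions in the `(2π)⁻ⁿ` normalization. -/

section Schwartz

variable {n : ℕ}

theorem schwartzHat_eq_fourier (ψ : 𝓢(EuclideanSpace ℝ (Fin n), ℂ))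
    (t : EuclideanSpace ℝ (Fin n)) :
    schwartzHat ψ t = (((2 * Real.pi) ^ n : ℝ) : ℂ)⁻¹ *
      FourierTransform.fourier (ψ : EuclideanSpace ℝ (Fin n) → ℂ) ((2 * Real.pi)⁻¹ • t) := by
  rw [schwartzHat, Real.fourier_eq']
  congr 2
  ext ω
  rw [smul_eq_mul, inner_smul_right]
  congr 2
  push_cast
  have : (Real.pi : ℂ) ≠ 0 := by exact_mod_cast Real.pi_ne_zero
  field_simp

theorem integrable_schwartzHat (ψ : 𝓢(EuclideanSpace ℝ (Fin n), ℂ)) :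
    Integrable (schwartzHat ψ) := by
  have h : Integrable (FourierTransform.fourier (ψ : EuclideanSpace ℝ (Fin n) → ℂ)) := by
    rw [← SchwartzMap.fourier_coe]
    exact SchwartzMap.integrable _
  have h2 := (h.comp_smul (R := (2 * Real.pi)⁻¹) (by positivity)).const_mul
    ((((2 * Real.pi) ^ n : ℝ) : ℂ)⁻¹)
  exact h2.congr (ae_of_all _ fun t => (schwartzHat_eq_fourier ψ t).symm)

theorem integral_exp_inner_mul_schwartzHat (ψ : 𝓢(EuclideanSpace ℝ (Fin n), ℂ))
    (ω : EuclideanSpace ℝ (Fin n)) :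
    ∫ t, Complex.exp (Complex.I * (inner ℝ ω t : ℝ)) * schwartzHat ψ t = ψ ω := by
  have hinv := congrFun (ψ.continuous.fourierInv_fourier_eq ψ.integrable
    (by rw [← SchwartzMap.fourier_coe]; exact SchwartzMap.integrable _)) ω
  rw [Real.fourierInv_eq'] at hinv
  have hs := Measure.integral_comp_smul volume (fun t : EuclideanSpace ℝ (Fin n) =>
    Complex.exp ((2 * Real.pi * inner ℝ t ω : ℝ) * Complex.I) •
      FourierTransform.fourier (ψ : EuclideanSpace ℝ (Fin n) → ℂ) t) (2 * Real.pi)⁻¹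
  rw [hinv, finrank_euclideanSpace, Fintype.card_fin, inv_pow, inv_inv,
    abs_of_pos (by positivity)] at hs
  have hne : (((2 * Real.pi) ^ n : ℝ) : ℂ) ≠ 0 := by
    exact_mod_cast (by positivity : ((2 * Real.pi) ^ n : ℝ) ≠ 0)
  have hpt : (fun t => Complex.exp (Complex.I * (inner ℝ ω t : ℝ)) * schwartzHat ψ t) = fun t =>
      (((2 * Real.pi) ^ n : ℝ) : ℂ)⁻¹ *
      (Complex.exp ((2 * Real.pi * inner ℝ ((2 * Real.pi)⁻¹ • t) ω : ℝ) * Complex.I) •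
      FourierTransform.fourier (ψ : EuclideanSpace ℝ (Fin n) → ℂ) ((2 * Real.pi)⁻¹ • t)) := by
    ext t
    rw [schwartzHat_eq_fourier, inner_smul_left, smul_eq_mul]
    have : (2 * Real.pi * ((starRingEnd ℝ) (2 * Real.pi)⁻¹ * inner ℝ t ω) : ℝ)
        = inner ℝ ω t := by
      rw [conj_trivial, mul_inv_cancel_left₀ (by positivity), real_inner_comm]
    rw [this, mul_comm Complex.I]
    ring
  rw [hpt, integral_const_mul, hs, Complex.real_smul, inv_mul_cancel_left₀ hne]

end Schwartz

/-! ### From a Gaussian mixture to the spectral density. -/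

/-- A Gaussian mixture `C(t) = ∫ g(τ) exp(-τ‖t‖²) dτ` has the corresponding mixture of heat
kernels as its spectral density. -/
theorem isSpectralDensity_of_gaussianMixture {n : ℕ} (hn : 1 ≤ n)
    {C S : EuclideanSpace ℝ (Fin n) → ℝ} {g : ℝ → ℝ} (hg : IntegrableOn g (Ioi 0))
    (hC : ∀ t, C t = ∫ τ in Ioi (0 : ℝ), g τ * Real.exp (-(τ * ‖t‖ ^ 2)))
    (hS : ∀ ω, ω ≠ 0 → S ω = ∫ τ in Ioi (0 : ℝ), g τ * heatDensity n τ ‖ω‖) :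
    IsSpectralDensity C S := by
  -- For `n ≥ 1` Lebesgue measure has no atoms, so the value of `S` at the origin is immaterial.
  have : Nonempty (Fin n) := ⟨⟨0, hn⟩⟩
  have hae : (fun ω => ∫ τ in Ioi (0 : ℝ), g τ * heatDensity n τ ‖ω‖) =ᵐ[volume] S := by
    filter_upwards [compl_mem_ae_iff.2 (measure_singleton (0 : EuclideanSpace ℝ (Fin n)))]
      with ω hω
    exact (hS ω hω).symm
  have hSint : Integrable S := (integrable_heatMixture hg).congr hae
  have hinv : ∀ t, (C t : ℂ) =
      ∫ ω, Complex.exp (Complex.I * (inner ℝ ω t : ℝ)) * (S ω : ℂ) := by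
    intro t
    rw [hC, ← integral_exp_inner_mul_heatMixture hg t]
    refine integral_congr_ae ?_
    filter_upwards [hae] with ω hω
    rw [hω]
  have hSC : Integrable fun ω => (S ω : ℂ) := hSint.ofReal
  have hCbd : ∀ t, ‖(C t : ℂ)‖ ≤ ∫ ω, ‖(S ω : ℂ)‖ := by
    intro t
    rw [hinv t]
    refine (norm_integral_le_integral_norm _).trans_eq ?_
    congr 1
    ext ω
    rw [norm_mul, mul_comm Complex.I, Complex.norm_exp_ofReal_mul_I, one_mul]
  have hjoint : ∀ h : EuclideanSpace ℝ (Fin n) → ℂ, Integrable h →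
      Integrable (fun p : EuclideanSpace ℝ (Fin n) × EuclideanSpace ℝ (Fin n) =>
        Complex.exp (Complex.I * (inner ℝ p.2 p.1 : ℝ)) * (h p.1 * (S p.2 : ℂ))) := by
    intro h hh
    refine (hh.mul_prod hSC).bdd_mul (c := 1) ?_ (ae_of_all _ fun p => ?_)
    · exact Continuous.aestronglyMeasurable (by fun_prop)
    · rw [mul_comm, Complex.norm_exp_ofReal_mul_I]
  -- Measurability of `C` comes from the inversion formula, which exhibits it as a parameter
  -- integral.
  have hCm : AEStronglyMeasurable (fun t => (C t : ℂ)) := by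
    have : AEStronglyMeasurable (fun p : EuclideanSpace ℝ (Fin n) × EuclideanSpace ℝ (Fin n) =>
        Complex.exp (Complex.I * (inner ℝ p.2 p.1 : ℝ)) * (S p.2 : ℂ)) :=
      (Continuous.aestronglyMeasurable (by fun_prop)).mul hSC.aestronglyMeasurable.comp_snd
    exact this.integral_prod_right'.congr (ae_of_all _ fun t => (hinv t).symm)
  refine ⟨fun ω hω L hL => ?_, fun ψ => ⟨?_, ?_, ?_⟩, hSint, hinv⟩
  · have hne : (((2 * Real.pi) ^ n : ℝ) : ℂ) ≠ 0 := by
      exact_mod_cast (by positivity : ((2 * Real.pi) ^ n : ℝ) ≠ 0)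
    have h1 := hL.const_mul (((2 * Real.pi) ^ n : ℝ) : ℂ)
    simp only [mul_inv_cancel_left₀ hne] at h1
    -- The Gaussian means tend to `(2π)ⁿ L` by Abel summation and to `(2π)ⁿ S ω` by the mixture
    -- formula.
    have h2 := tendsto_integral_exp_neg_mul_sq_norm_mul
      (f := fun t => Complex.exp (-Complex.I * (inner ℝ ω t : ℝ)) * (C t : ℂ))
      ((Continuous.aestronglyMeasurable (by fun_prop)).mul hCm)
      (fun t => by
        rw [norm_mul, neg_mul, ← mul_neg, mul_comm Complex.I, ← Complex.ofReal_neg,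
          Complex.norm_exp_ofReal_mul_I, one_mul]
        exact hCbd t) h1
    have h3 := ((Complex.continuous_ofReal.tendsto _).comp
      (tendsto_integral_mul_heatDensity_add hn hg (norm_ne_zero_iff.2 hω))).const_mul
      (((2 * Real.pi) ^ n : ℝ) : ℂ)
    have h4 := tendsto_nhds_unique (h2.congr' ?_) h3
    · rw [hS ω hω]
      exact (mul_left_cancel₀ hne h4).symm
    · filter_upwards [self_mem_nhdsWithin] with ε hε
      simp only [hC, Function.comp_apply]
      exact integral_gaussian_mul_laplace hg hε ω
  · exact hSC.mul_bdd (c := SchwartzMap.seminorm ℝ 0 0 ψ) ψ.continuous.aestronglyMeasurable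
      (ae_of_all _ fun ω => SchwartzMap.norm_le_seminorm ℝ ψ ω)
  · exact (integrable_schwartzHat ψ).bdd_mul hCm (ae_of_all _ hCbd)
  · have hfub := integral_integral_swap
      (f := fun t ω : EuclideanSpace ℝ (Fin n) =>
        Complex.exp (Complex.I * (inner ℝ ω t : ℝ)) * (schwartzHat ψ t * (S ω : ℂ)))
      (hjoint _ (integrable_schwartzHat ψ))
    have hl : ∀ t, (C t : ℂ) * schwartzHat ψ t = ∫ ω,
        Complex.exp (Complex.I * (inner ℝ ω t : ℝ)) * (schwartzHat ψ t * (S ω : ℂ)) := by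
      intro t
      rw [hinv t, ← integral_mul_const]
      congr 1
      ext ω
      ring
    simp only [hl]
    rw [hfub]
    congr 1
    ext ω
    rw [← integral_exp_inner_mul_schwartzHat ψ ω, ← integral_const_mul]
    congr 1
    ext t
    ring

/-! ### Boundary values of the generalized Cauchy function. -/

/-- The boundary value `(1 + e^{iπα/2} u^α)^(-β)` of the generalized Cauchy function. -/
noncomputable def cauchyBoundary (α β u : ℝ) : ℂ :=
  (1 + Complex.exp (Complex.I * Real.pi * α / 2) * ((u ^ α : ℝ) : ℂ)) ^ (-(β : ℂ))

/-- The generalized Cauchy function `(1 + z^α)^(-β)` in the logarithmic coordinate `z = e^v`. -/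
noncomputable def cauchyLog (α β : ℝ) (v : ℂ) : ℂ :=
  (1 + Complex.exp (α * v)) ^ (-(β : ℂ))

theorem one_add_exp_mem_slitPlane {w : ℂ} (hw : |w.im| < Real.pi) :
    1 + Complex.exp w ∈ Complex.slitPlane := by
  rw [Complex.mem_slitPlane_iff]
  by_cases h : Real.sin w.im = 0
  · left
    have h0 : w.im = 0 :=
      (Real.sin_eq_zero_iff_of_lt_of_lt (abs_lt.1 hw).1 (abs_lt.1 hw).2).1 h
    rw [Complex.add_re, Complex.exp_re, h0, Real.cos_zero, Complex.one_re]
    positivity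
  · right
    rw [Complex.add_im, Complex.exp_im, Complex.one_im, zero_add]
    exact mul_ne_zero (Real.exp_pos _).ne' h

theorem norm_cpow_neg_ofReal (z : ℂ) (β : ℝ) : ‖z ^ (-(β : ℂ))‖ = ‖z‖ ^ (-β) := by
  rw [← Complex.ofReal_neg, Complex.norm_cpow_real]

theorem norm_one_add_cpow_neg_le {β : ℝ} (hβ : 0 < β) {w : ℂ} {c : ℝ} (hc : 0 < c)
    (h : c ≤ ‖1 + w‖) : ‖(1 + w) ^ (-(β : ℂ))‖ ≤ c ^ (-β) := by
  rw [norm_cpow_neg_ofReal]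
  exact Real.rpow_le_rpow_of_nonpos hc h (by linarith)

section Boundary

variable {α β : ℝ}

theorem cauchyLog_add_I (s : ℝ) :
    cauchyLog α β (s + (Real.pi / 2 : ℝ) * Complex.I) = cauchyBoundary α β (Real.exp s) := by
  rw [cauchyLog, cauchyBoundary, ← Real.exp_mul, Complex.ofReal_exp, ← Complex.exp_add]
  congr 3
  push_cast
  ring

/-- For `α < 2` the closed strip of half-width `π/2` is scaled strictly inside `|Im| < π`, where `1
+ e^w` avoids the branch cut. -/
theorem abs_mul_im_lt (hα : 0 < α) (hα2 : α < 2) {v : ℂ} (hv : |v.im| ≤ Real.pi / 2) :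
    |((α : ℂ) * v).im| < Real.pi := by
  rw [Complex.im_ofReal_mul, abs_mul, abs_of_pos hα]
  nlinarith [Real.pi_pos]

theorem cauchyLog_conj (hα : 0 < α) (hα2 : α < 2) {v : ℂ} (hv : |v.im| ≤ Real.pi / 2) :
    cauchyLog α β ((starRingEnd ℂ) v) = (starRingEnd ℂ) (cauchyLog α β v) := by
  have h := Complex.slitPlane_arg_ne_pi (one_add_exp_mem_slitPlane (abs_mul_im_lt hα hα2 hv))
  have h2 := Complex.conj_cpow _ (-(β : ℂ)) h
  rw [cauchyLog, cauchyLog]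
  simpa [← Complex.exp_conj] using h2

theorem differentiableAt_cauchyLog (hα : 0 < α) (hα2 : α < 2) {v : ℂ}
    (hv : |v.im| ≤ Real.pi / 2) : DifferentiableAt ℂ (cauchyLog α β) v := by
  unfold cauchyLog
  exact DifferentiableAt.cpow_const (by fun_prop)
    (one_add_exp_mem_slitPlane (abs_mul_im_lt hα hα2 hv))

theorem norm_exp_ofReal_mul (v : ℂ) : ‖Complex.exp (α * v)‖ = Real.exp (α * v.re) := by
  rw [Complex.norm_exp, Complex.re_ofReal_mul]

/-- Rotating by `e^(-iθ)` gives `e^(-iθ) + x`, whose imaginary part is `-sin θ`. -/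
theorem abs_sin_le_norm_one_add (θ x : ℝ) :
    |Real.sin θ| ≤ ‖1 + Complex.exp (Complex.I * θ) * (x : ℂ)‖ := by
  have h : ‖Complex.exp (-Complex.I * θ) * (1 + Complex.exp (Complex.I * θ) * (x : ℂ))‖
      = ‖1 + Complex.exp (Complex.I * θ) * (x : ℂ)‖ := by
    rw [norm_mul, neg_mul, ← mul_neg, mul_comm, ← Complex.ofReal_neg,
      mul_comm Complex.I ((-θ : ℝ) : ℂ), Complex.norm_exp_ofReal_mul_I, mul_one]
  rw [← h]
  refine le_trans (le_of_eq ?_) (Complex.abs_im_le_norm _)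
  rw [mul_add, ← mul_assoc, ← Complex.exp_add]
  have : Complex.exp (-Complex.I * θ) = Complex.exp (((-θ : ℝ) : ℂ) * Complex.I) := by
    congr 1; push_cast; ring
  rw [show -Complex.I * (θ : ℂ) + Complex.I * θ = 0 by ring, Complex.exp_zero, one_mul, mul_one,
    this, Complex.add_im, Complex.ofReal_im, add_zero, Complex.exp_ofReal_mul_I_im, Real.sin_neg,
    abs_neg]

theorem norm_cauchyBoundary_le (hα : 0 < α) (hα2 : α < 2) (hβ : 0 < β) (u : ℝ) :
    ‖cauchyBoundary α β u‖ ≤ (Real.sin (Real.pi * α / 2)) ^ (-β) := by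
  have hsin : 0 < Real.sin (Real.pi * α / 2) := by
    apply Real.sin_pos_of_pos_of_lt_pi
    · positivity
    · nlinarith [Real.pi_pos]
  refine norm_one_add_cpow_neg_le hβ hsin ?_
  have h := abs_sin_le_norm_one_add (Real.pi * α / 2) (u ^ α)
  rw [abs_of_pos hsin] at h
  convert h using 4
  push_cast
  ring_nf

theorem norm_exp_I_mul_boundary {u : ℝ} (hu : 0 ≤ u) :
    ‖Complex.exp (Complex.I * Real.pi * α / 2) * ((u ^ α : ℝ) : ℂ)‖ = u ^ α := by
  rw [norm_mul, Complex.norm_real, Real.norm_of_nonneg (Real.rpow_nonneg hu _),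
    show Complex.I * Real.pi * α / 2 = ((Real.pi * α / 2 : ℝ) : ℂ) * Complex.I by push_cast; ring,
    Complex.norm_exp_ofReal_mul_I, one_mul]

theorem continuousOn_cauchyBoundary (hα : 0 < α) (hα2 : α < 2) :
    ContinuousOn (cauchyBoundary α β) (Ioi 0) := by
  have h1 : Continuous fun s : ℝ => cauchyBoundary α β (Real.exp s) := by
    simp only [← cauchyLog_add_I]
    refine continuous_iff_continuousAt.2 fun s => ?_
    refine ContinuousAt.comp (g := cauchyLog α β)
      (differentiableAt_cauchyLog hα hα2 ?_).continuousAt (by fun_prop)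
    simp [abs_of_pos (half_pos Real.pi_pos)]
  have h2 : ContinuousOn (fun u : ℝ => cauchyBoundary α β (Real.exp (Real.log u))) (Ioi 0) :=
    h1.comp_continuousOn (Real.continuousOn_log.mono fun x hx => (mem_Ioi.1 hx).ne')
  exact h2.congr fun u hu => by simp only [Real.exp_log hu]

/-- The imaginary part is unchanged on subtracting 1, and `(1 + w)^(-β) - 1 = O(w)` with `|w| =
u^α`. The exponent `-(-α)` has the shape the Mellin convergence criterion expects. -/
theorem isBigO_cauchyBoundary_im_zero (hα : 0 < α) :
    (fun u => (cauchyBoundary α β u).im) =O[𝓝[>] 0] fun u : ℝ => u ^ (-(-α)) := by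
  have hd : DifferentiableAt ℂ (fun w : ℂ => (1 + w) ^ (-(β : ℂ))) 0 :=
    DifferentiableAt.cpow_const (by fun_prop) (by simp)
  have ht : Tendsto (fun u : ℝ => Complex.exp (Complex.I * Real.pi * α / 2) * ((u ^ α : ℝ) : ℂ))
      (𝓝[>] 0) (𝓝 0) := by
    rw [tendsto_zero_iff_norm_tendsto_zero]
    have h : Tendsto (fun u : ℝ => u ^ α) (𝓝[>] 0) (𝓝 0) := by
      have := (Real.continuousAt_rpow_const 0 α (Or.inr hα.le)).tendsto
      rw [Real.zero_rpow hα.ne'] at this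
      exact this.mono_left nhdsWithin_le_nhds
    refine h.congr' ?_
    filter_upwards [self_mem_nhdsWithin] with u hu
    exact (norm_exp_I_mul_boundary (le_of_lt hu)).symm
  have hO := hd.isBigO_sub.comp_tendsto ht
  have h1 : (fun u => cauchyBoundary α β u - 1) =O[𝓝[>] 0] fun u : ℝ => u ^ (-(-α)) := by
    refine hO.norm_right.congr' (Eventually.of_forall fun u => ?_) ?_
    · simp [cauchyBoundary]
    · filter_upwards [self_mem_nhdsWithin] with u hu
      rw [neg_neg, Function.comp_apply, sub_zero]
      exact norm_exp_I_mul_boundary (le_of_lt hu)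
  refine Asymptotics.IsBigO.trans (Asymptotics.IsBigO.of_bound 1
    (Eventually.of_forall fun u => ?_)) h1
  rw [one_mul, Real.norm_eq_abs]
  simpa using Complex.abs_im_le_norm (cauchyBoundary α β u - 1)

theorem isBigO_cauchyBoundary_im_atTop (hα : 0 < α) (hβ : 0 < β) :
    (fun u => (cauchyBoundary α β u).im) =O[atTop] fun u : ℝ => u ^ (-(α * β)) := by
  refine Asymptotics.IsBigO.of_bound ((2 : ℝ) ^ β) ?_
  filter_upwards [eventually_gt_atTop 0, (tendsto_rpow_atTop hα).eventually_ge_atTop 2]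
    with u hu h2
  rw [Real.norm_of_nonneg (Real.rpow_nonneg hu.le _), Real.norm_eq_abs]
  refine (Complex.abs_im_le_norm _).trans ?_
  -- As `u^α ≥ 2`, one has `|1 + w| ≥ u^α - 1 ≥ u^α / 2`.
  have h := norm_one_add_cpow_neg_le hβ (c := u ^ α / 2)
    (w := Complex.exp (Complex.I * Real.pi * α / 2) * ((u ^ α : ℝ) : ℂ)) (by positivity) (by
      have h1 := norm_sub_le_norm_add
        (Complex.exp (Complex.I * Real.pi * α / 2) * ((u ^ α : ℝ) : ℂ)) 1
      rw [norm_exp_I_mul_boundary hu.le, norm_one, add_comm] at h1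
      linarith)
  refine h.trans_eq ?_
  rw [Real.div_rpow (by positivity) (by norm_num), ← Real.rpow_mul hu.le,
    Real.rpow_neg (by norm_num : (0 : ℝ) ≤ 2), div_inv_eq_mul, mul_comm, mul_neg]

/-- This is Mellin convergence at `s = 0`, which lies between the decay exponents `-α` and `αβ`. It
is what makes the mixing weight integrable. -/
theorem integrableOn_inv_mul_cauchyBoundary_im (hα : 0 < α) (hα2 : α < 2) (hβ : 0 < β) :
    IntegrableOn (fun u : ℝ => u⁻¹ * (cauchyBoundary α β u).im) (Ioi 0) := by
  have hloc : LocallyIntegrableOn (fun u => (cauchyBoundary α β u).im) (Ioi 0) :=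
    (Complex.continuous_im.comp_continuousOn
      (continuousOn_cauchyBoundary hα hα2)).locallyIntegrableOn measurableSet_Ioi
  have h := mellin_convergent_of_isBigO_scalar (s := 0) hloc
    (isBigO_cauchyBoundary_im_atTop hα hβ) (by positivity)
    (isBigO_cauchyBoundary_im_zero hα) (by linarith)
  simpa [Real.rpow_neg_one] using h

end Boundary

/-! ### Cauchy's theorem in the strip `|Im v| ≤ π/2`. -/

/-- The Cauchy kernel `z² / (z² - x²)`, `z = e^v`, `x = e^y`, applied to the increment of
`cauchyLog α β` from `y`. -/
noncomputable def cauchyIncrement (α β y : ℝ) (v : ℂ) : ℂ :=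
  (cauchyLog α β v - cauchyLog α β y) *
    (Complex.exp (2 * v) / (Complex.exp (2 * v) - Complex.exp (2 * y)))

/-- The continuous extension of `cauchyIncrement α β y` to the point `y`. -/
noncomputable def cauchyIncrementExt (α β y : ℝ) (v : ℂ) : ℂ :=
  dslope (cauchyLog α β) y v *
    (Complex.exp (2 * v) / dslope (fun w : ℂ => Complex.exp (2 * w)) y v)

section Strip

variable {α β y : ℝ}

theorem cauchyIncrementExt_of_ne {v : ℂ} (hv : v ≠ y) :
    cauchyIncrementExt α β y v = cauchyIncrement α β y v := by
  have h : v - y ≠ 0 := sub_ne_zero.2 hv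
  rw [cauchyIncrementExt, cauchyIncrement, dslope_of_ne _ hv, dslope_of_ne _ hv, slope_def_field,
    slope_def_field]
  rw [div_div_eq_mul_div, div_mul_div_comm, mul_div_assoc']
  -- If `v` differs from `y` by a nonzero multiple of `πi`, division by zero makes both sides 0, so
  -- no strip condition is needed.
  rcases eq_or_ne (Complex.exp (2 * v) - Complex.exp (2 * (y : ℂ))) 0 with h0 | h0
  · simp [h0]
  · field_simp

/-- `e^(2v) = e^(2y)` forces `Im v ∈ πℤ`, which in the strip leaves only `v = y`; there the
derivative is nonzero. -/
theorem dslope_exp_two_mul_ne_zero {v : ℂ} (hv : |v.im| ≤ Real.pi / 2) :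
    dslope (fun w : ℂ => Complex.exp (2 * w)) y v ≠ 0 := by
  rcases eq_or_ne v y with rfl | hne
  · have hd : HasDerivAt (fun w : ℂ => Complex.exp (2 * w)) (Complex.exp (2 * y) * (2 * 1)) y :=
      ((hasDerivAt_id (y : ℂ)).const_mul 2).cexp
    rw [dslope_same, hd.deriv]
    exact mul_ne_zero (Complex.exp_ne_zero _) (by norm_num)
  · rw [dslope_of_ne _ hne, slope_def_field]
    refine div_ne_zero (fun h => hne ?_) (sub_ne_zero.2 hne)
    obtain ⟨k, hk⟩ := Complex.exp_eq_exp_iff_exists_int.1 (sub_eq_zero.1 h)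
    have him := congrArg Complex.im hk
    simp at him
    have hk0 : k = 0 := by
      have hv' : v.im = k * Real.pi := by linarith
      rw [hv', abs_mul, abs_of_pos Real.pi_pos] at hv
      have h1 : |(k : ℝ)| < 1 := by nlinarith [Real.pi_pos]
      exact Int.abs_lt_one_iff.1 (by exact_mod_cast h1)
    rw [hk0] at hk
    have : (2 : ℂ) * v = 2 * y := by simpa using hk
    exact mul_left_cancel₀ two_ne_zero this

theorem continuousAt_cauchyIncrementExt (hα : 0 < α) (hα2 : α < 2) {v : ℂ}
    (hv : |v.im| ≤ Real.pi / 2) : ContinuousAt (cauchyIncrementExt α β y) v := by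
  have hc : ∀ {f : ℂ → ℂ}, (∀ w : ℂ, |w.im| ≤ Real.pi / 2 → DifferentiableAt ℂ f w) →
      ContinuousAt (dslope f y) v := by
    intro f hf
    rcases eq_or_ne v y with h | hne
    · rw [h]
      exact continuousAt_dslope_same.2 (h ▸ hf v hv)
    · exact (continuousAt_dslope_of_ne hne).2 (hf v hv).continuousAt
  refine ContinuousAt.mul (hc fun w hw => differentiableAt_cauchyLog hα hα2 hw) ?_
  exact ContinuousAt.div (by fun_prop) (hc fun w _ => by fun_prop) (dslope_exp_two_mul_ne_zero hv)

theorem differentiableAt_cauchyIncrementExt (hα : 0 < α) (hα2 : α < 2) {v : ℂ}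
    (hv : |v.im| ≤ Real.pi / 2) (hne : v ≠ y) :
    DifferentiableAt ℂ (cauchyIncrementExt α β y) v := by
  refine DifferentiableAt.mul
    ((differentiableAt_dslope_of_ne hne).2 (differentiableAt_cauchyLog hα hα2 hv)) ?_
  exact DifferentiableAt.div (by fun_prop) ((differentiableAt_dslope_of_ne hne).2 (by fun_prop))
    (dslope_exp_two_mul_ne_zero hv)

/-- Subtracting `F(y)` has removed the pole, so continuity at the single exceptional point `y`
suffices and no residue appears. -/
theorem integral_boundary_cauchyIncrementExt (hα : 0 < α) (hα2 : α < 2) (R : ℝ) :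
    (∫ s in (-R)..R, (cauchyIncrementExt α β y (s + ((-(Real.pi / 2) : ℝ) : ℂ) * Complex.I) -
        cauchyIncrementExt α β y (s + ((Real.pi / 2 : ℝ) : ℂ) * Complex.I))) +
      Complex.I * (∫ θ in (-(Real.pi / 2))..(Real.pi / 2),
        cauchyIncrementExt α β y (R + θ * Complex.I)) -
      Complex.I * (∫ θ in (-(Real.pi / 2))..(Real.pi / 2),
        cauchyIncrementExt α β y ((-R : ℝ) + θ * Complex.I)) = 0 := by
  have hp := Real.pi_pos
  have hle : -(Real.pi / 2) ≤ Real.pi / 2 := by linarith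
  have h := Complex.integral_boundary_rect_eq_zero_of_differentiable_on_off_countable
    (cauchyIncrementExt α β y) ⟨-R, -(Real.pi / 2)⟩ ⟨R, Real.pi / 2⟩ {(y : ℂ)}
    (countable_singleton _) ?_ ?_
  · rw [intervalIntegral.integral_sub]
    · exact h
    all_goals
      refine Continuous.intervalIntegrable (continuous_iff_continuousAt.2 fun s => ?_) _ _
      refine ContinuousAt.comp (g := cauchyIncrementExt α β y)
        (continuousAt_cauchyIncrementExt hα hα2 ?_) (by fun_prop)
      simp [abs_of_pos (half_pos hp)]
  · intro v hv
    rw [Complex.mem_reProdIm, uIcc_of_le hle] at hv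
    exact (continuousAt_cauchyIncrementExt hα hα2 (abs_le.2 hv.2)).continuousWithinAt
  · rintro v ⟨hv, hne⟩
    rw [Complex.mem_reProdIm, min_eq_left hle, max_eq_right hle] at hv
    exact differentiableAt_cauchyIncrementExt hα hα2 (abs_le.2 ⟨hv.2.1.le, hv.2.2.le⟩) hne

theorem cauchyLog_ofReal (y : ℝ) :
    cauchyLog α β y = (((1 + Real.exp (α * y)) ^ (-β) : ℝ) : ℂ) := by
  rw [Complex.ofReal_cpow (by positivity), cauchyLog]
  push_cast
  rfl

/-- On both edges `e^(2v) = -e^(2s)`, so the kernel is real and common to them. The values of `F`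
are conjugate, and the subtracted constant cancels. -/
theorem cauchyIncrementExt_sub (hα : 0 < α) (hα2 : α < 2) (s : ℝ) :
    cauchyIncrementExt α β y (s + ((-(Real.pi / 2) : ℝ) : ℂ) * Complex.I) -
        cauchyIncrementExt α β y (s + ((Real.pi / 2 : ℝ) : ℂ) * Complex.I) =
      2 * Complex.I * ((-(cauchyBoundary α β (Real.exp s)).im *
        (Real.exp (2 * s) / (Real.exp (2 * s) + Real.exp (2 * y))) : ℝ) : ℂ) := by
  have hp := Real.pi_pos
  have hne : ∀ c : ℝ, c ≠ 0 → (s : ℂ) + (c : ℂ) * Complex.I ≠ y := by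
    intro c hc h
    have := congrArg Complex.im h
    simp at this
    exact hc this
  rw [cauchyIncrementExt_of_ne (hne _ (by linarith)), cauchyIncrementExt_of_ne (hne _ (by linarith)),
    cauchyIncrement, cauchyIncrement]
  have hconj : (s : ℂ) + ((-(Real.pi / 2) : ℝ) : ℂ) * Complex.I =
      (starRingEnd ℂ) (s + ((Real.pi / 2 : ℝ) : ℂ) * Complex.I) := by
    rw [map_add, map_mul, Complex.conj_ofReal, Complex.conj_ofReal, Complex.conj_I,
      Complex.ofReal_neg]
    ring
  have e1 : Complex.exp (2 * (s + ((Real.pi / 2 : ℝ) : ℂ) * Complex.I)) =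
      ((-Real.exp (2 * s) : ℝ) : ℂ) := by
    rw [show 2 * ((s : ℂ) + ((Real.pi / 2 : ℝ) : ℂ) * Complex.I) = 2 * s + Real.pi * Complex.I by
      push_cast; ring, Complex.exp_add, Complex.exp_pi_mul_I]
    push_cast
    ring
  have e2 : Complex.exp (2 * (s + ((-(Real.pi / 2) : ℝ) : ℂ) * Complex.I)) =
      ((-Real.exp (2 * s) : ℝ) : ℂ) := by
    have h := congrArg (starRingEnd ℂ) e1
    rw [← Complex.exp_conj, Complex.conj_ofReal, map_mul, ← hconj, Complex.conj_ofNat] at h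
    exact h
  have hF : cauchyLog α β (s + ((-(Real.pi / 2) : ℝ) : ℂ) * Complex.I) =
      (starRingEnd ℂ) (cauchyBoundary α β (Real.exp s)) := by
    rw [hconj, cauchyLog_conj hα hα2 (by simp [abs_of_pos (half_pos hp)]), cauchyLog_add_I]
  have hk : Complex.exp (2 * (y : ℂ)) = ((Real.exp (2 * y) : ℝ) : ℂ) := by push_cast; rfl
  rw [e1, e2, hF, cauchyLog_add_I, hk, ← sub_mul, sub_sub_sub_cancel_right, ← neg_sub,
    Complex.sub_conj]
  have hker : -Real.exp (2 * s) / (-Real.exp (2 * s) - Real.exp (2 * y)) =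
      Real.exp (2 * s) / (Real.exp (2 * s) + Real.exp (2 * y)) := by
    rw [← neg_add', neg_div_neg_eq]
  rw [← Complex.ofReal_sub, ← Complex.ofReal_div, hker]
  push_cast
  ring

end Strip

/-! ### Letting the rectangle grow: the Stieltjes representation. -/

/-- Convergence along `comap Complex.re l` is uniform in the imaginary part, which supplies the
constant dominating function. -/
theorem tendsto_intervalIntegral_vertical {G : ℂ → ℂ} (hG : Measurable G) {l : Filter ℝ}
    [l.IsCountablyGenerated] {L : ℂ} (h : Tendsto G (comap Complex.re l) (𝓝 L)) (a b : ℝ) :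
    Tendsto (fun R : ℝ => ∫ θ in a..b, G (R + θ * Complex.I)) l (𝓝 ((b - a) • L)) := by
  have hre : ∀ R θ : ℝ, ((R : ℂ) + θ * Complex.I).re = R := by intro R θ; simp
  rw [← intervalIntegral.integral_const]
  refine intervalIntegral.tendsto_integral_filter_of_dominated_convergence (fun _ => ‖L‖ + 1)
    ?_ ?_ intervalIntegrable_const ?_
  · refine Eventually.of_forall fun R => ?_
    exact (hG.comp (by fun_prop)).aestronglyMeasurable
  · have h1 := h.norm.eventually_le_const (lt_add_one ‖L‖)
    rw [eventually_comap] at h1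
    filter_upwards [h1] with R hR
    exact ae_of_all _ fun θ _ => hR _ (hre R θ)
  · refine ae_of_all _ fun θ _ => h.comp ?_
    rw [tendsto_comap_iff]
    exact tendsto_id.congr fun R => (hre R θ).symm

section Limits

variable {α β y : ℝ}

theorem measurable_cauchyIncrement : Measurable (cauchyIncrement α β y) := by
  have h : Measurable (cauchyLog α β) := by
    unfold cauchyLog
    exact Measurable.pow_const (by fun_prop) _
  unfold cauchyIncrement
  exact (h.sub_const _).mul (by fun_prop)

theorem tendsto_norm_exp_mul_atTop (hα : 0 < α) :
    Tendsto (fun v : ℂ => ‖Complex.exp (α * v)‖) (comap Complex.re atTop) atTop := by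
  simp only [norm_exp_ofReal_mul]
  exact Real.tendsto_exp_atTop.comp (tendsto_comap.const_mul_atTop hα)

theorem tendsto_exp_mul_atBot (hα : 0 < α) :
    Tendsto (fun v : ℂ => Complex.exp (α * v)) (comap Complex.re atBot) (𝓝 0) := by
  rw [tendsto_zero_iff_norm_tendsto_zero]
  simp only [norm_exp_ofReal_mul]
  exact Real.tendsto_exp_atBot.comp (tendsto_comap.const_mul_atBot hα)

theorem tendsto_cauchyLog_atTop (hα : 0 < α) (hβ : 0 < β) :
    Tendsto (cauchyLog α β) (comap Complex.re atTop) (𝓝 0) := by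
  rw [tendsto_zero_iff_norm_tendsto_zero]
  simp only [cauchyLog, norm_cpow_neg_ofReal]
  refine (tendsto_rpow_neg_atTop hβ).comp ?_
  refine tendsto_atTop_mono (fun v => ?_)
    (tendsto_atTop_add_const_right _ (-1) (tendsto_norm_exp_mul_atTop hα))
  have h1 := norm_sub_le_norm_add (Complex.exp (α * v)) 1
  rw [norm_one, add_comm (Complex.exp _)] at h1
  linarith

theorem tendsto_cauchyLog_atBot (hα : 0 < α) :
    Tendsto (cauchyLog α β) (comap Complex.re atBot) (𝓝 1) := by
  have hd : ContinuousAt (fun w : ℂ => (1 + w) ^ (-(β : ℂ))) 0 :=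
    (DifferentiableAt.cpow_const (by fun_prop) (by simp)).continuousAt
  have h := hd.tendsto.comp (tendsto_exp_mul_atBot hα)
  simp only [add_zero, Complex.one_cpow] at h
  exact h

theorem tendsto_cauchyIncrement_atTop (hα : 0 < α) (hβ : 0 < β) :
    Tendsto (cauchyIncrement α β y) (comap Complex.re atTop) (𝓝 (-cauchyLog α β y)) := by
  have h1 : Tendsto (fun v : ℂ => (1 - Complex.exp (2 * y) * (Complex.exp (2 * v))⁻¹)⁻¹)
      (comap Complex.re atTop) (𝓝 1) := by
    have h0 : Tendsto (fun v : ℂ => (Complex.exp (2 * v))⁻¹) (comap Complex.re atTop) (𝓝 0) := by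
      have := tendsto_norm_exp_mul_atTop (α := 2) two_pos
      push_cast at this
      exact tendsto_inv₀_cobounded.comp (tendsto_norm_atTop_iff_cobounded.1 this)
    have h2 := (tendsto_const_nhds (x := (1 : ℂ))).sub (h0.const_mul (Complex.exp (2 * y)))
    rw [mul_zero, sub_zero] at h2
    simpa using h2.inv₀ one_ne_zero
  have h2 := ((tendsto_cauchyLog_atTop hα hβ).sub_const (cauchyLog α β y)).mul h1
  rw [zero_sub, mul_one] at h2
  refine h2.congr fun v => ?_
  have hne := Complex.exp_ne_zero (2 * v)
  have hk : Complex.exp (2 * v) - Complex.exp (2 * (y : ℂ)) =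
      Complex.exp (2 * v) * (1 - Complex.exp (2 * y) * (Complex.exp (2 * v))⁻¹) := by
    field_simp
  rw [cauchyIncrement, hk, div_mul_cancel_left₀ hne]

theorem tendsto_cauchyIncrement_atBot (hα : 0 < α) :
    Tendsto (cauchyIncrement α β y) (comap Complex.re atBot) (𝓝 0) := by
  have h0 := tendsto_exp_mul_atBot (α := 2) two_pos
  push_cast at h0
  have h1 := h0.div (h0.sub_const (Complex.exp (2 * y))) (by simp [Complex.exp_ne_zero])
  have h2 := ((tendsto_cauchyLog_atBot hα (β := β)).sub_const (cauchyLog α β y)).mul h1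
  rw [zero_div, mul_zero] at h2
  exact h2

/-- The vertical line at `R ≠ y` misses `y`, so the extension may be replaced by the evidently
measurable `cauchyIncrement`. -/
theorem tendsto_integral_cauchyIncrementExt {l : Filter ℝ} [l.IsCountablyGenerated]
    (hl : ∀ᶠ R in l, R ≠ y) {L : ℂ}
    (h : Tendsto (cauchyIncrement α β y) (comap Complex.re l) (𝓝 L)) :
    Tendsto (fun R : ℝ => ∫ θ in (-(Real.pi / 2))..(Real.pi / 2),
      cauchyIncrementExt α β y (R + θ * Complex.I)) l (𝓝 (Real.pi • L)) := by
  have h1 := tendsto_intervalIntegral_vertical measurable_cauchyIncrement h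
    (-(Real.pi / 2)) (Real.pi / 2)
  rw [sub_neg_eq_add, add_halves] at h1
  refine h1.congr' ?_
  filter_upwards [hl] with R hR
  refine intervalIntegral.integral_congr fun θ _ => (cauchyIncrementExt_of_ne fun h => hR ?_).symm
  simpa using congrArg Complex.re h

theorem integrable_cauchyBoundary_exp_im_mul (hα : 0 < α) (hα2 : α < 2) (hβ : 0 < β) :
    Integrable fun s : ℝ => -(cauchyBoundary α β (Real.exp s)).im *
      (Real.exp (2 * s) / (Real.exp (2 * s) + Real.exp (2 * y))) := by
  have h := (integrableOn_Ioi_zero_iff_integrable_comp_exp _).1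
    (integrableOn_inv_mul_cauchyBoundary_im hα hα2 hβ)
  have h' : Integrable fun s : ℝ => (cauchyBoundary α β (Real.exp s)).im := by
    refine h.congr (ae_of_all _ fun s => ?_)
    simp only [smul_eq_mul]
    rw [mul_inv_cancel_left₀ (Real.exp_pos s).ne']
  refine h'.neg.mul_bdd (c := 1) ?_ (ae_of_all _ fun s => ?_)
  · refine Continuous.aestronglyMeasurable ?_
    exact Continuous.div (by fun_prop) (by fun_prop) fun s => by positivity
  · rw [Real.norm_of_nonneg (by positivity), div_le_one (by positivity)]
    linarith [Real.exp_pos (2 * y)]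

theorem integral_cauchyBoundary_exp_im_mul (hα : 0 < α) (hα2 : α < 2) (hβ : 0 < β) :
    ∫ s : ℝ, -(cauchyBoundary α β (Real.exp s)).im *
      (Real.exp (2 * s) / (Real.exp (2 * s) + Real.exp (2 * y))) =
      Real.pi / 2 * (1 + Real.exp (α * y)) ^ (-β) := by
  have hR := tendsto_integral_cauchyIncrementExt (eventually_ne_atTop y)
    (tendsto_cauchyIncrement_atTop hα hβ)
  have hL := (tendsto_integral_cauchyIncrementExt (eventually_ne_atBot y)
    (tendsto_cauchyIncrement_atBot hα (β := β))).comp tendsto_neg_atTop_atBot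
  have hint : Integrable fun s : ℝ => ((-(cauchyBoundary α β (Real.exp s)).im *
      (Real.exp (2 * s) / (Real.exp (2 * s) + Real.exp (2 * y))) : ℝ) : ℂ) :=
    (integrable_cauchyBoundary_exp_im_mul hα hα2 hβ).ofReal
  have hI := (intervalIntegral_tendsto_integral hint
    tendsto_neg_atTop_atBot tendsto_id).const_mul (2 * Complex.I)
  have hsum := ((hI.add (hR.const_mul Complex.I)).sub (hL.const_mul Complex.I))
  -- The right side tends to `-iπ F(y)` and the left side to 0, so `2i ∫ = iπ F(y)`.
  have h0 := tendsto_nhds_unique hsum (tendsto_const_nhds.congr fun R => ?_ :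
    Tendsto _ _ (𝓝 (0 : ℂ)))
  · rw [integral_complex_ofReal, cauchyLog_ofReal, smul_zero, mul_zero, sub_zero,
      Complex.real_smul] at h0
    have h1 : Complex.I * (2 * ((∫ s : ℝ, -(cauchyBoundary α β (Real.exp s)).im *
      (Real.exp (2 * s) / (Real.exp (2 * s) + Real.exp (2 * y))) : ℝ) : ℂ)) =
      Complex.I * (Real.pi * (((1 + Real.exp (α * y)) ^ (-β) : ℝ) : ℂ)) := by
      linear_combination h0
    have h2 := mul_left_cancel₀ Complex.I_ne_zero h1
    have h3 : 2 * (∫ s : ℝ, -(cauchyBoundary α β (Real.exp s)).im *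
      (Real.exp (2 * s) / (Real.exp (2 * s) + Real.exp (2 * y)))) =
      Real.pi * (1 + Real.exp (α * y)) ^ (-β) := by exact_mod_cast h2
    linarith
  · have h := integral_boundary_cauchyIncrementExt (β := β) (y := y) hα hα2 R
    simp only [cauchyIncrementExt_sub hα hα2, intervalIntegral.integral_const_mul] at h
    exact h.symm

/-- Stieltjes representation of the generalized Cauchy function. -/
theorem integral_cauchyBoundary_im_mul_div (hα : 0 < α) (hα2 : α < 2) (hβ : 0 < β) {x : ℝ}
    (hx : 0 < x) :
    ∫ u in Ioi (0 : ℝ), -(cauchyBoundary α β u).im * (u / (u ^ 2 + x ^ 2)) =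
      Real.pi / 2 * (1 + x ^ α) ^ (-β) := by
  have hexp : ∀ s : ℝ, Real.exp (2 * s) = Real.exp s ^ 2 := fun s => by
    rw [← Real.exp_nat_mul]; norm_cast
  have h := integral_cauchyBoundary_exp_im_mul hα hα2 hβ (y := Real.log x)
  rw [hexp (Real.log x), Real.exp_log hx, mul_comm α, Real.exp_mul, Real.exp_log hx] at h
  rw [integral_Ioi_zero_eq_integral_comp_exp, ← h]
  congr 1
  ext s
  rw [hexp, smul_eq_mul]
  ring

end Limits

/-! ### Laplace-type integrals of the heat kernel. -/

theorem exp_neg_mul_mul_heatDensity_eq (n : ℕ) {a r τ : ℝ} (ha : 0 < a) (hr : 0 < r) (hτ : 0 < τ)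
    (p : ℝ) :
    τ ^ (p - 1) * Real.exp (-(τ * a ^ 2)) * heatDensity n τ r =
      (4 * Real.pi) ^ (-((n : ℝ) / 2)) * (τ ^ (p - (n : ℝ) / 2 - 1) *
        Real.exp (-(r * a / 2 * (τ / (r / (2 * a)) + r / (2 * a) / τ)))) := by
  have e : Real.exp (-(r * a / 2 * (τ / (r / (2 * a)) + r / (2 * a) / τ))) =
      Real.exp (-(τ * a ^ 2)) * Real.exp (-(r ^ 2 / (4 * τ))) := by
    rw [← Real.exp_add]
    congr 1
    field_simp
    ring
  rw [e, heatDensity, Real.mul_rpow (by positivity) hτ.le,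
    show p - (n : ℝ) / 2 - 1 = (p - 1) + -((n : ℝ) / 2) by ring, Real.rpow_add hτ]
  ring

/-- The Gamma–heat integral `∫ τ^(p-1) exp(-τ a²) (4πτ)^(-n/2) exp(-r²/(4τ)) dτ`. -/
theorem integral_rpow_mul_exp_mul_heatDensity (n : ℕ) {a r : ℝ} (ha : 0 < a) (hr : 0 < r) (p : ℝ) :
    ∫ τ in Ioi (0 : ℝ), τ ^ (p - 1) * Real.exp (-(τ * a ^ 2)) * heatDensity n τ r =
      (4 * Real.pi) ^ (-((n : ℝ) / 2)) * (2 * (r / (2 * a)) ^ (p - (n : ℝ) / 2) *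
        besselK (p - (n : ℝ) / 2) (r * a)) := by
  rw [← integral_rpow_mul_exp_eq_besselK _ (div_pos hr (by positivity)) (by positivity),
    ← integral_const_mul]
  exact setIntegral_congr_fun measurableSet_Ioi fun τ hτ =>
    exp_neg_mul_mul_heatDensity_eq n ha hr hτ p

theorem integral_Ioi_exp_neg_mul {a : ℝ} (ha : 0 < a) :
    IntegrableOn (fun τ : ℝ => Real.exp (-(τ * a))) (Ioi 0) ∧
      ∫ τ in Ioi (0 : ℝ), Real.exp (-(τ * a)) = a⁻¹ := by
  have h1 := integrableOn_exp_mul_Ioi (neg_lt_zero.2 ha) 0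
  have h2 := integral_exp_mul_Ioi (neg_lt_zero.2 ha) 0
  simp only [neg_mul, mul_comm a, mul_zero, Real.exp_zero] at h1 h2
  exact ⟨h1, by rw [h2, neg_div_neg_eq, one_div]⟩

/-! ### The mixing weight for `0 < α < 2`. -/

section Mixing

variable {α β : ℝ}

/-- The density `(2/π) ∫ -Im (1 + e^{iπα/2} u^α)^(-β) u exp(-τ u²) du` with which the generalized
Cauchy covariance is a mixture of Gaussians. -/
noncomputable def cauchyMixing (α β τ : ℝ) : ℝ :=
  ∫ u in Ioi (0 : ℝ), 2 / Real.pi * (-(cauchyBoundary α β u).im * (u * Real.exp (-(τ * u ^ 2))))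

/-- Integrating in `τ` first turns `u exp(-τu²)` into `u⁻¹`. -/
theorem integrable_cauchyMixing_prod (hα : 0 < α) (hα2 : α < 2) (hβ : 0 < β) :
    Integrable (fun p : ℝ × ℝ =>
      2 / Real.pi * (-(cauchyBoundary α β p.1).im * (p.1 * Real.exp (-(p.2 * p.1 ^ 2)))))
      ((volume.restrict (Ioi 0)).prod (volume.restrict (Ioi 0))) := by
  have him : AEStronglyMeasurable (fun u => (cauchyBoundary α β u).im)
      (volume.restrict (Ioi 0)) :=
    (Complex.continuous_im.comp_continuousOn
      (continuousOn_cauchyBoundary hα hα2)).aestronglyMeasurable measurableSet_Ioi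
  refine Integrable.const_mul ?_ _
  rw [integrable_prod_iff]
  · constructor
    · filter_upwards [ae_restrict_mem measurableSet_Ioi] with u hu
      have hu' : (0 : ℝ) < u := hu
      exact ((integral_Ioi_exp_neg_mul (by positivity : 0 < u ^ 2)).1.const_mul _).const_mul _
    · refine (integrableOn_inv_mul_cauchyBoundary_im hα hα2 hβ).norm.congr ?_
      filter_upwards [ae_restrict_mem measurableSet_Ioi] with u hu
      have hu' : (0 : ℝ) < u := hu
      simp only [norm_mul, norm_neg, Real.norm_of_nonneg (Real.exp_pos _).le,
        integral_const_mul, (integral_Ioi_exp_neg_mul (by positivity : 0 < u ^ 2)).2, norm_inv]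
      rw [Real.norm_of_nonneg hu'.le]
      field_simp
  · refine (him.comp_fst.neg).mul ?_
    exact Continuous.aestronglyMeasurable (by fun_prop)

theorem integrableOn_cauchyMixing (hα : 0 < α) (hα2 : α < 2) (hβ : 0 < β) :
    IntegrableOn (cauchyMixing α β) (Ioi 0) :=
  (integrable_cauchyMixing_prod hα hα2 hβ).integral_prod_right

/-- Used twice: with a Gaussian for the covariance, and with the heat kernel for the density. -/
theorem integral_cauchyMixing_mul (hα : 0 < α) (hα2 : α < 2) (hβ : 0 < β) {h : ℝ → ℝ} {M : ℝ}
    (hm : Measurable h) (hM : ∀ τ, 0 < τ → ‖h τ‖ ≤ M) :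
    ∫ τ in Ioi (0 : ℝ), cauchyMixing α β τ * h τ =
      2 / Real.pi * ∫ u in Ioi (0 : ℝ), -(cauchyBoundary α β u).im *
        (u * ∫ τ in Ioi (0 : ℝ), Real.exp (-(τ * u ^ 2)) * h τ) := by
  have hint : Integrable (fun p : ℝ × ℝ =>
      2 / Real.pi * (-(cauchyBoundary α β p.1).im * (p.1 * Real.exp (-(p.2 * p.1 ^ 2)))) * h p.2)
      ((volume.restrict (Ioi 0)).prod (volume.restrict (Ioi 0))) := by
    refine (integrable_cauchyMixing_prod hα hα2 hβ).mul_bdd (c := M)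
      (hm.comp measurable_snd).aestronglyMeasurable ?_
    have : ∀ᵐ p : ℝ × ℝ ∂((volume.restrict (Ioi 0)).prod (volume.restrict (Ioi 0))),
        p.2 ∈ Ioi (0 : ℝ) :=
      Measure.quasiMeasurePreserving_snd.ae (ae_restrict_mem measurableSet_Ioi)
    filter_upwards [this] with p hp using hM _ hp
  have hfub := integral_integral_swap (f := fun u τ : ℝ =>
    2 / Real.pi * (-(cauchyBoundary α β u).im * (u * Real.exp (-(τ * u ^ 2)))) * h τ) hint
  simp only [cauchyMixing, ← integral_mul_const]
  rw [← hfub, ← integral_const_mul]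
  congr 1
  ext u
  rw [← integral_const_mul, ← integral_const_mul, ← integral_const_mul]
  congr 1
  ext τ
  ring

theorem laplace_cauchyMixing_of_pos (hα : 0 < α) (hα2 : α < 2) (hβ : 0 < β) {x : ℝ}
    (hx : 0 < x) :
    ∫ τ in Ioi (0 : ℝ), cauchyMixing α β τ * Real.exp (-(τ * x ^ 2)) = (1 + x ^ α) ^ (-β) := by
  rw [integral_cauchyMixing_mul hα hα2 hβ (M := 1) (by fun_prop) fun τ hτ => ?_]
  · have h := integral_cauchyBoundary_im_mul_div hα hα2 hβ hx
    have he : ∀ u : ℝ, u * ∫ τ in Ioi (0 : ℝ), Real.exp (-(τ * u ^ 2)) * Real.exp (-(τ * x ^ 2)) =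
        u / (u ^ 2 + x ^ 2) := by
      intro u
      simp only [← Real.exp_add, ← neg_add, ← mul_add]
      rw [(integral_Ioi_exp_neg_mul (by positivity : 0 < u ^ 2 + x ^ 2)).2, div_eq_mul_inv]
    simp only [he]
    rw [h, ← mul_assoc, div_mul_div_cancel₀ Real.pi_ne_zero, div_self two_ne_zero, one_mul]
  · rw [Real.norm_of_nonneg (Real.exp_pos _).le, Real.exp_le_one_iff]
    have : 0 ≤ τ * x ^ 2 := by positivity
    linarith

/-- The Stieltjes formula needs `x > 0`; the value at 0 follows by continuity of both sides. -/
theorem laplace_cauchyMixing (hα : 0 < α) (hα2 : α < 2) (hβ : 0 < β) {x : ℝ} (hx : 0 ≤ x) :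
    ∫ τ in Ioi (0 : ℝ), cauchyMixing α β τ * Real.exp (-(τ * x ^ 2)) = (1 + x ^ α) ^ (-β) := by
  rcases hx.eq_or_lt with rfl | hx
  · have hg := integrableOn_cauchyMixing hα hα2 hβ
    have h1 : Tendsto
        (fun x : ℝ => ∫ τ in Ioi (0 : ℝ), cauchyMixing α β τ * Real.exp (-(τ * x ^ 2))) (𝓝[>] 0)
        (𝓝 (∫ τ in Ioi (0 : ℝ), cauchyMixing α β τ * Real.exp (-(τ * 0 ^ 2)))) := by
      refine tendsto_integral_filter_of_dominated_convergence (fun τ => ‖cauchyMixing α β τ‖)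
        ?_ ?_ hg.norm ?_
      · exact Eventually.of_forall fun x => hg.aestronglyMeasurable.mul
          (Continuous.aestronglyMeasurable (by fun_prop))
      · refine Eventually.of_forall fun x => ?_
        filter_upwards [ae_restrict_mem measurableSet_Ioi] with τ hτ
        have hτ' : (0 : ℝ) < τ := hτ
        rw [norm_mul]
        refine mul_le_of_le_one_right (norm_nonneg _) ?_
        rw [Real.norm_of_nonneg (Real.exp_pos _).le, Real.exp_le_one_iff]
        have : 0 ≤ τ * x ^ 2 := by positivity
        linarith
      · refine ae_of_all _ fun τ => ?_
        have hc : Continuous fun x : ℝ => cauchyMixing α β τ * Real.exp (-(τ * x ^ 2)) := by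
          fun_prop
        exact (hc.tendsto 0).mono_left nhdsWithin_le_nhds
    have h2 : Tendsto (fun x : ℝ => (1 + x ^ α) ^ (-β)) (𝓝[>] 0) (𝓝 ((1 + 0 ^ α) ^ (-β))) := by
      have hc : ContinuousAt (fun x : ℝ => (1 + x ^ α) ^ (-β)) 0 := by
        refine ContinuousAt.rpow_const
          (continuousAt_const.add (Real.continuousAt_rpow_const 0 α (Or.inr hα.le))) (Or.inl ?_)
        simp [Real.zero_rpow hα.ne']
      exact hc.tendsto.mono_left nhdsWithin_le_nhds
    refine tendsto_nhds_unique (h1.congr' ?_) h2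
    filter_upwards [self_mem_nhdsWithin] with x hx
    exact laplace_cauchyMixing_of_pos hα hα2 hβ hx
  · exact laplace_cauchyMixing_of_pos hα hα2 hβ hx

end Mixing

/-! ### The Bessel integral for `0 < α < 2`. -/

theorem mul_integral_exp_mul_heatDensity (n : ℕ) {r u : ℝ} (hr : 0 < r) (hu : 0 < u) :
    u * ∫ τ in Ioi (0 : ℝ), Real.exp (-(τ * u ^ 2)) * heatDensity n τ r =
      2 * (4 * Real.pi) ^ (-((n : ℝ) / 2)) * (r / 2) ^ (1 - (n : ℝ) / 2) *
        (besselK (((n : ℝ) - 2) / 2) (r * u) * u ^ ((n : ℝ) / 2)) := by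
  have h := integral_rpow_mul_exp_mul_heatDensity n hu hr 1
  simp only [sub_self, Real.rpow_zero, one_mul] at h
  rw [h, show 1 - (n : ℝ) / 2 = -(((n : ℝ) - 2) / 2) by ring, besselK_neg,
    show r / (2 * u) = r / 2 * u⁻¹ by field_simp,
    Real.mul_rpow (x := r / 2) (y := u⁻¹) (by positivity) (by positivity),
    Real.inv_rpow hu.le, Real.rpow_neg hu.le, inv_inv,
    show (n : ℝ) / 2 = ((n : ℝ) - 2) / 2 + 1 by ring, Real.rpow_add hu, Real.rpow_one]
  ring_nf

/-- The substitution `τ ↦ 1/τ` reduces this to a Gamma integral with exponent `n/2 - 1 > -1`. -/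
theorem integrableOn_heatDensity_div {n : ℕ} (hn : 1 ≤ n) {r : ℝ} (hr : 0 < r) :
    IntegrableOn (fun τ => heatDensity n τ r * (2 * τ)⁻¹) (Ioi 0) := by
  have hn' : (0 : ℝ) < (n : ℝ) / 2 := by positivity
  have h := integrableOn_rpow_mul_exp_neg_mul_rpow (s := (n : ℝ) / 2 - 1) (p := 1)
    (b := r ^ 2 / 4) (by linarith) one_pos (by positivity)
  rw [← integrableOn_Ioi_comp_rpow_iff _ (by norm_num : (-1 : ℝ) ≠ 0)] at h
  refine IntegrableOn.congr_fun (h.const_mul ((4 * Real.pi) ^ (-((n : ℝ) / 2)) / 2))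
    (fun τ hτ => ?_) measurableSet_Ioi
  have hτ' : (0 : ℝ) < τ := hτ
  simp only [Real.rpow_one, smul_eq_mul, abs_neg, abs_one, one_mul, heatDensity]
  rw [Real.mul_rpow (by positivity) hτ'.le, ← Real.rpow_mul hτ'.le, Real.rpow_neg_one,
    show -(r ^ 2 / 4) * τ⁻¹ = -(r ^ 2 / (4 * τ)) by field_simp]
  have e : τ ^ (-(1:ℝ) - 1) * τ ^ (-1 * ((n : ℝ) / 2 - 1)) = τ ^ (-((n : ℝ) / 2)) * τ⁻¹ := by
    rw [← Real.rpow_neg_one τ, ← Real.rpow_add hτ', ← Real.rpow_add hτ']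
    congr 1
    ring
  rw [mul_inv]
  linear_combination (4 * Real.pi) ^ (-((n : ℝ) / 2)) / 2 * Real.exp (-(r ^ 2 / (4 * τ))) * e

theorem integral_Ioi_mul_exp_neg_mul_sq {τ : ℝ} (hτ : 0 < τ) :
    IntegrableOn (fun u : ℝ => u * Real.exp (-(τ * u ^ 2))) (Ioi 0) ∧
      ∫ u in Ioi (0 : ℝ), u * Real.exp (-(τ * u ^ 2)) = (2 * τ)⁻¹ := by
  have h1 := integrableOn_rpow_mul_exp_neg_mul_rpow (s := 1) (p := 2) (b := τ) (by norm_num)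
    two_pos hτ
  have h2 := integral_rpow_mul_exp_neg_mul_rpow (p := 2) (q := 1) two_pos (by norm_num) hτ
  simp only [Real.rpow_one, Real.rpow_two, neg_mul] at h1 h2
  refine ⟨h1, h2.trans ?_⟩
  norm_num [Real.rpow_neg_one]

/-- No Bessel asymptotics are needed: up to a constant the integrand is a `τ`-integral of positive
terms, and integrating in `u` first leaves `heatDensity n τ r / (2τ)`. -/
theorem integrableOn_besselK_mul_rpow {n : ℕ} (hn : 1 ≤ n) {r : ℝ} (hr : 0 < r) :
    IntegrableOn (fun u : ℝ => besselK (((n : ℝ) - 2) / 2) (r * u) * u ^ ((n : ℝ) / 2))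
      (Ioi 0) := by
  have hint : Integrable (fun p : ℝ × ℝ =>
      p.1 * (Real.exp (-(p.2 * p.1 ^ 2)) * heatDensity n p.2 r))
      ((volume.restrict (Ioi 0)).prod (volume.restrict (Ioi 0))) := by
    rw [integrable_prod_iff']
    · constructor
      · filter_upwards [ae_restrict_mem measurableSet_Ioi] with τ hτ
        simpa only [mul_assoc] using (integral_Ioi_mul_exp_neg_mul_sq hτ).1.mul_const _
      · refine (integrableOn_heatDensity_div hn hr).congr ?_
        filter_upwards [ae_restrict_mem measurableSet_Ioi] with τ hτ
        rw [← (integral_Ioi_mul_exp_neg_mul_sq hτ).2, ← integral_const_mul]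
        refine setIntegral_congr_fun measurableSet_Ioi fun u hu => ?_
        have hu' : (0 : ℝ) < u := hu
        have := heatDensity_nonneg n hτ r
        rw [Real.norm_of_nonneg (by positivity)]
        ring
    · have hm : Measurable fun p : ℝ × ℝ => heatDensity n p.2 r :=
        (measurable_heatDensity n).comp (measurable_snd.prodMk measurable_const)
      exact (measurable_fst.mul (Measurable.mul (by fun_prop) hm)).aestronglyMeasurable
  have h := hint.integral_prod_left
  simp only [integral_const_mul] at h
  have hc : (2 * (4 * Real.pi) ^ (-((n : ℝ) / 2)) * (r / 2) ^ (1 - (n : ℝ) / 2)) ≠ 0 := by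
    positivity
  refine (IntegrableOn.congr_fun (h.const_mul
    (2 * (4 * Real.pi) ^ (-((n : ℝ) / 2)) * (r / 2) ^ (1 - (n : ℝ) / 2))⁻¹)
    (fun u hu => ?_) measurableSet_Ioi)
  rw [mul_integral_exp_mul_heatDensity n hr hu, inv_mul_cancel_left₀ hc]

theorem integrableOn_gfgccIntegrand {n : ℕ} (hn : 1 ≤ n) {α β r : ℝ} (hα : 0 < α) (hα2 : α < 2)
    (hβ : 0 < β) (hr : 0 < r) : IntegrableOn (gfgccIntegrand n α β r) (Ioi 0) :=
  (integrableOn_besselK_mul_rpow hn hr).ofReal.mul_bdd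
    ((continuousOn_cauchyBoundary hα hα2).aestronglyMeasurable measurableSet_Ioi)
    (ae_of_all _ (norm_cauchyBoundary_le hα hα2 hβ))

theorem spectralConstant_cauchy (n : ℕ) {r : ℝ} (hr : 0 < r) :
    2 / Real.pi * (2 * (4 * Real.pi) ^ (-((n : ℝ) / 2)) * (r / 2) ^ (1 - (n : ℝ) / 2)) =
      r ^ ((2 - (n : ℝ)) / 2) /
        ((2 : ℝ) ^ (((n : ℝ) - 2) / 2) * Real.pi ^ (((n : ℝ) + 2) / 2)) := by
  have hp := Real.pi_pos
  have h4 : (4 : ℝ) ^ (-((n : ℝ) / 2)) = (2 : ℝ) ^ (-(n : ℝ)) := by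
    rw [show (4 : ℝ) = 2 ^ (2 : ℝ) by norm_num, ← Real.rpow_mul two_pos.le]
    congr 1
    ring
  have h2 : (2 : ℝ) ^ (((n : ℝ) - 2) / 2) = (2 : ℝ) ^ ((n : ℝ)) * 2 ^ (1 - (n : ℝ) / 2) / 4 := by
    rw [← Real.rpow_add two_pos, show (4 : ℝ) = 2 ^ (2 : ℝ) by norm_num, ← Real.rpow_sub two_pos]
    congr 1
    ring
  rw [Real.mul_rpow (by norm_num) hp.le, h4, Real.div_rpow hr.le two_pos.le, h2,
    Real.rpow_neg two_pos.le, Real.rpow_neg hp.le,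
    show ((n : ℝ) + 2) / 2 = (n : ℝ) / 2 + 1 by ring, Real.rpow_add_one hp.ne',
    show (2 - (n : ℝ)) / 2 = 1 - (n : ℝ) / 2 by ring]
  field_simp
  norm_num

theorem integral_cauchyMixing_mul_heatDensity {n : ℕ} (hn : 1 ≤ n) {α β r : ℝ} (hα : 0 < α)
    (hα2 : α < 2) (hβ : 0 < β) (hr : 0 < r) :
    ∫ τ in Ioi (0 : ℝ), cauchyMixing α β τ * heatDensity n τ r =
      -(r ^ ((2 - (n : ℝ)) / 2) /
        ((2 : ℝ) ^ (((n : ℝ) - 2) / 2) * Real.pi ^ (((n : ℝ) + 2) / 2))) *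
        (∫ u in Ioi (0 : ℝ), gfgccIntegrand n α β r u).im := by
  obtain ⟨M, hM⟩ := exists_heatDensity_le hn hr.ne'
  rw [integral_cauchyMixing_mul (h := fun τ => heatDensity n τ r) hα hα2 hβ (M := M)
    ((measurable_heatDensity n).comp
      (measurable_id.prodMk measurable_const))
    (fun τ hτ => by rw [Real.norm_of_nonneg (heatDensity_nonneg n hτ r)]; exact hM τ hτ),
    ← spectralConstant_cauchy n hr]
  have him : (∫ u in Ioi (0 : ℝ), gfgccIntegrand n α β r u).im =
      ∫ u in Ioi (0 : ℝ), (gfgccIntegrand n α β r u).im :=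
    (integral_im (integrableOn_gfgccIntegrand hn hα hα2 hβ hr)).symm
  rw [him, neg_mul, ← mul_neg, ← integral_neg, mul_assoc]
  congr 1
  rw [← integral_const_mul]
  refine setIntegral_congr_fun measurableSet_Ioi fun u hu => ?_
  have hg : (gfgccIntegrand n α β r u).im =
      besselK (((n : ℝ) - 2) / 2) (r * u) * u ^ ((n : ℝ) / 2) * (cauchyBoundary α β u).im :=
    Complex.im_ofReal_mul _ _
  rw [hg, mul_integral_exp_mul_heatDensity n hr hu]
  ring

/-! ### The Gamma mixture for `α = 2`. -/

theorem spectralConstant_gamma (n : ℕ) (β : ℝ) {r : ℝ} (hr : 0 < r) :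
    (4 * Real.pi) ^ (-((n : ℝ) / 2)) * (2 * (r / 2) ^ (β - (n : ℝ) / 2)) / Real.Gamma β =
      r ^ (β - (n : ℝ) / 2) /
        ((2 : ℝ) ^ ((n : ℝ) / 2 + β - 1) * Real.pi ^ ((n : ℝ) / 2) * Real.Gamma β) := by
  have hp := Real.pi_pos
  have h4 : (4 : ℝ) ^ (-((n : ℝ) / 2)) = (2 : ℝ) ^ (-(n : ℝ)) := by
    rw [show (4 : ℝ) = 2 ^ (2 : ℝ) by norm_num, ← Real.rpow_mul two_pos.le]
    congr 1
    ring
  have h2 : (2 : ℝ) ^ ((n : ℝ) / 2 + β - 1) = (2 : ℝ) ^ (n : ℝ) * 2 ^ (β - (n : ℝ) / 2) / 2 := by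
    rw [← Real.rpow_add two_pos, ← Real.rpow_sub_one two_ne_zero]
    congr 1
    ring
  rw [Real.mul_rpow (by norm_num) hp.le, h4, Real.div_rpow hr.le two_pos.le, h2,
    Real.rpow_neg two_pos.le, Real.rpow_neg hp.le]
  field_simp

/-- The Gamma density `τ^(β-1) e^(-τ) / Γ(β)`. -/
noncomputable def gammaMixing (β τ : ℝ) : ℝ :=
  τ ^ (β - 1) * Real.exp (-τ) / Real.Gamma β

theorem integrableOn_gammaMixing {β : ℝ} (hβ : 0 < β) : IntegrableOn (gammaMixing β) (Ioi 0) := by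
  have h := (Real.GammaIntegral_convergent hβ).div_const (Real.Gamma β)
  refine IntegrableOn.congr_fun h (fun τ _ => ?_) measurableSet_Ioi
  rw [gammaMixing, mul_comm (Real.exp _)]

theorem laplace_gammaMixing {β : ℝ} (hβ : 0 < β) (x : ℝ) :
    ∫ τ in Ioi (0 : ℝ), gammaMixing β τ * Real.exp (-(τ * x ^ 2)) = (1 + x ^ 2) ^ (-β) := by
  have h := Real.integral_rpow_mul_exp_neg_mul_Ioi hβ (by positivity : 0 < 1 + x ^ 2)
  have hG := (Real.Gamma_pos_of_pos hβ).ne'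
  have he : ∀ τ : ℝ, gammaMixing β τ * Real.exp (-(τ * x ^ 2)) =
      τ ^ (β - 1) * Real.exp (-((1 + x ^ 2) * τ)) / Real.Gamma β := by
    intro τ
    rw [gammaMixing, show -((1 + x ^ 2) * τ) = -τ + -(τ * x ^ 2) by ring, Real.exp_add]
    ring
  simp only [he]
  rw [integral_div, h, mul_div_cancel_right₀ _ hG, one_div, Real.inv_rpow (by positivity),
    Real.rpow_neg (by positivity)]

theorem integral_gammaMixing_mul_heatDensity (n : ℕ) (β : ℝ) {r : ℝ} (hr : 0 < r) :
    ∫ τ in Ioi (0 : ℝ), gammaMixing β τ * heatDensity n τ r =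
      r ^ (β - (n : ℝ) / 2) /
        ((2 : ℝ) ^ ((n : ℝ) / 2 + β - 1) * Real.pi ^ ((n : ℝ) / 2) * Real.Gamma β) *
        besselK ((n : ℝ) / 2 - β) r := by
  have h := integral_rpow_mul_exp_mul_heatDensity n one_pos hr β
  simp only [one_pow, mul_one] at h
  have he : ∀ τ : ℝ, gammaMixing β τ * heatDensity n τ r =
      τ ^ (β - 1) * Real.exp (-τ) * heatDensity n τ r / Real.Gamma β := by
    intro τ
    rw [gammaMixing]
    ring
  simp only [he]
  rw [integral_div, h, ← spectralConstant_gamma n β hr, ← besselK_neg, neg_sub]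
  ring

/-! ### The main theorem. -/

theorem covarianceFunction_eq {Ω : Type*} [MeasurableSpace Ω] {P : Measure Ω} {n : ℕ} {α β : ℝ}
    {X : EuclideanSpace ℝ (Fin n) → Ω → ℝ} (hX : IsGFGCC α β P X) (t : EuclideanSpace ℝ (Fin n)) :
    covarianceFunction P X t = (1 + ‖t‖ ^ α) ^ (-β) := by
  simpa [covarianceFunction] using hX.covariance 0 t

theorem mainTheorem3 {Ω : Type*} [MeasurableSpace Ω] (P : Measure Ω) [IsProbabilityMeasure P]
    (n : ℕ) (hn : 1 ≤ n) (α β : ℝ) (hβ : 0 < β)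
    (X : EuclideanSpace ℝ (Fin n) → Ω → ℝ) (hX : IsGFGCC α β P X) :
    (0 < α → α < 2 →
      (∀ ω : EuclideanSpace ℝ (Fin n), ω ≠ 0 →
        IntegrableOn (fun u : ℝ => gfgccIntegrand n α β ‖ω‖ u) (Ioi 0)) ∧
      IsSpectralDensity (covarianceFunction P X) (fun ω =>
        -(‖ω‖ ^ ((2 - (n : ℝ)) / 2) /
            ((2 : ℝ) ^ (((n : ℝ) - 2) / 2) * Real.pi ^ (((n : ℝ) + 2) / 2))) *
          (∫ u in Ioi (0 : ℝ), gfgccIntegrand n α β ‖ω‖ u).im)) ∧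
    (α = 2 →
      IsSpectralDensity (covarianceFunction P X) (fun ω =>
        ‖ω‖ ^ (β - (n : ℝ) / 2) /
            ((2 : ℝ) ^ ((n : ℝ) / 2 + β - 1) * Real.pi ^ ((n : ℝ) / 2) * Real.Gamma β) *
          besselK ((n : ℝ) / 2 - β) ‖ω‖)) := by
  refine ⟨fun hα hα2 => ⟨fun ω hω =>
    integrableOn_gfgccIntegrand hn hα hα2 hβ (norm_pos_iff.2 hω), ?_⟩, ?_⟩
  · exact isSpectralDensity_of_gaussianMixture hn (integrableOn_cauchyMixing hα hα2 hβ)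
      (fun t => by rw [covarianceFunction_eq hX, laplace_cauchyMixing hα hα2 hβ (norm_nonneg t)])
      fun ω hω => (integral_cauchyMixing_mul_heatDensity hn hα hα2 hβ (norm_pos_iff.2 hω)).symm
  · rintro rfl
    exact isSpectralDensity_of_gaussianMixture hn (integrableOn_gammaMixing hβ)
      (fun t => by rw [covarianceFunction_eq hX, laplace_gammaMixing hβ, Real.rpow_two])
      fun ω hω => (integral_gammaMixing_mul_heatDensity n β (norm_pos_iff.2 hω)).symm
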